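/- **Setting.** Let $\Gamma$ be an acyclic perfect network on an oriented cylinder with a cut: a finite directed graph without oriented cycles, embedded in the cylinder, with $N$ univalent sources on one boundary circle and $N$ univalent sinks on the other, and all internal vertices trivalent, each either white (one incoming, two outgoing edges) or black (two incoming, one outgoing edge). Draw the cylinder as a rectangle, its top and bottom being glued along the cut, with sources $1,\dots,N$ from top to bottom on the left side and sinks $1,\dots,N$ from top to bottom on the right side. Let $\mathbf k=\mathbb C(\lambda,\mu)$. Let $\mathcal C$ be the $\mathbf k$-linear category whose objects are the points $1,\dots,N$ obtained by gluing the $i$-th sink to the $i$-th source (so that $\Gamma$ becomes a network on a torus) and whose morphisms $i\to j$ are linear combinations of directed paths in the torus network; $fg$ denotes concatenation, $f$ first. Let $B(z)$ be the boundary measurement matrix, $B(z)_{ij}=\sum_p z^{d(p)}p$, over the paths $p$ in $\Gamma$ from source $i$ to sink $j$, where $d(p)$ is the oriented intersection number of $p$ with the cut (upward crossings count $+1$). **Brackets.** Paths of the torus network carry the double bracket $\{\!\{-,-\}\!\}:\mathrm{Hom}(a,b)\otimes\mathrm{Hom}(c,d)\to\mathrm{Hom}(c,b)\otimes\mathrm{Hom}(a,d)$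 determined by the double Leibniz identities $\{\!\{fg,h\}\!\}=(1\otimes f)\{\!\{g,h\}\!\}+\{\!\{f,h\}\!\}(g\otimes 1)$ and $\{\!\{f,gh\}\!\}=(g\otimes1)\{\!\{f,h\}\!\}+\{\!\{f,g\}\!\}(1\otimes h)$, by skew-symmetry, and by its values on edges, which are sums of the following local contributions of the internal vertices: $\{\!\{x_1,x_2\}\!\}=\tfrac12x_1\otimes x_2$ at a white vertex with outgoing edges $x_1,x_2$ and incoming edge $x_3$, where $(x_1,x_2,x_3)$ is the counter-clockwise order, and $\{\!\{y_1,y_2\}\!\}=-\tfrac12y_2\otimes y_1$ at a black vertex with incoming edges $y_1,y_2$ and outgoing edge $y_3$, where $(y_1,y_2,y_3)$ is the counter-clockwise order. It restricts to $\mathcal C$. Let $\mathcal C_\natural$ be the cyclic space, i.e. linear combinations of loops of $\mathcal C$ modulo all $fg-gf$. Composing the double bracket with concatenation induces a bracket $\{-,-\}:\mathcal C_\natural\otimes\mathcal C\to\mathcal C$. **Completion.** Let $X(\lambda)=B(\lambda)-\mathbf 1$ and let $J$ be a two-sided ideal of $\mathcal C$ containing all entries of $X(\lambda)$, for instance the ideal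 generated by them. Let $\hat{\mathcal C}=\varprojlim\mathcal C/J^m$ and let $\hat{\mathcal C}_\natural=\varprojlim\mathcal C_\natural/\overline{J^m}$, where $\overline{J^m}$ is spanned by the classes of the loops in $J^m$. (When $\mathcal C$ is freely generated by the entries of $X(\lambda)$ and $J$ is the ideal generated by them, $\hat{\mathcal C}$ is the space $\prod_m\mathcal C_{(m)}$ of formal power series in these entries.) The bracket extends continuously to $\{-,-\}:\hat{\mathcal C}_\natural\otimes\hat{\mathcal C}\to\hat{\mathcal C}$. **Proposition (Hamilton flow of $H=\tfrac12\mathrm{tr}(\log B)^2$).** Let $\log B(\lambda)=\sum_{k\ge1}\frac{(-1)^{k+1}}k(B(\lambda)-\mathbf 1)^k$, a matrix over $\hat{\mathcal C}$, and let $H(\lambda)\in\hat{\mathcal C}_\natural$ be the class of $\tfrac12\mathrm{tr}\big((\log B(\lambda))^2\big)$. Then, entrywise in $\hat{\mathcal C}$, $$\{H(\lambda),B(\mu)\}=\widetilde M(\lambda,\mu)\,B(\mu)-B(\mu)\,\widetilde M(\lambda,\mu),\qquad \widetilde M(\lambda,\mu)_{b_1b_2}=\rho_{b_2b_1}(\lambda,\mu)\,\big(\log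 B(\lambda)\big)_{b_1b_2},$$ where $\rho_{ij}(\lambda,\mu)$ equals $\frac{\lambda}{\mu-\lambda}$ if $i<j$, $\frac12\,\frac{\mu+\lambda}{\mu-\lambda}$ if $i=j$, and $\frac{\mu}{\mu-\lambda}$ if $i>j$. -/

import Mathlib

open scoped TensorProduct

noncomputable section

/-! ## The `K`-linear path category of a quiver -/

section PathCategory

/-- Morphisms `a → b` of the `K`-linear category freely generated by a quiver:
formal linear combinations of paths from `a` to `b`. -/
abbrev PathHom (K : Type*) [Field K] {V : Type*} [Quiver V] (a b : V) : Type _ :=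
  Quiver.Path a b →₀ K

variable {K : Type*} [Field K] {V : Type*} [Quiver V]

/-- A path regarded as a morphism. -/
def ofPath (K : Type*) [Field K] {V : Type*} [Quiver V] {a b : V} (p : Quiver.Path a b) :
    PathHom K a b :=
  Finsupp.single p 1

/-- Concatenation `f ⊗ g ↦ f g`, with `f` traversed first. -/
def concat {a b c : V} : PathHom K a b →ₗ[K] PathHom K b c →ₗ[K] PathHom K a c :=
  Finsupp.linearCombination K fun p => Finsupp.lmapDomain K K fun q => p.comp q

/-- Concatenation as a map on the tensor product. -/
def concatTensor {a b c : V} : PathHom K a b ⊗[K] PathHom K b c →ₗ[K] PathHom K a c :=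
  TensorProduct.lift concat

@[simp]
theorem concat_ofPath {a b c : V} (p : Quiver.Path a b) (q : Quiver.Path b c) :
    concat (ofPath K p) (ofPath K q) = ofPath K (p.comp q) := by
  simp [concat, ofPath]

theorem pathHom_ext {a b : V} {M : Type*} [AddCommGroup M] [Module K M]
    {f g : PathHom K a b →ₗ[K] M} (h : ∀ p, f (ofPath K p) = g (ofPath K p)) : f = g :=
  Finsupp.lhom_ext' fun p => LinearMap.ext_ring (h p)

theorem pathHom_induction {a b : V} {P : PathHom K a b → Prop} (x : PathHom K a b)
    (h0 : P 0) (hadd : ∀ x y, P x → P y → P (x + y)) (hsmul : ∀ (r : K) x, P x → P (r • x))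
    (hp : ∀ p, P (ofPath K p)) : P x := by
  induction x using Finsupp.induction_linear with
  | zero => exact h0
  | add f g hf hg => exact hadd f g hf hg
  | single p r =>
    have := hsmul r _ (hp p)
    simpa [ofPath] using this

theorem concat_assoc {a b c d : V} (f : PathHom K a b) (g : PathHom K b c) (h : PathHom K c d) :
    concat (concat f g) h = concat f (concat g h) := by
  induction f using pathHom_induction with
  | h0 => simp
  | hadd x y hx hy => simp [hx, hy]
  | hsmul r x hx => simp [hx]
  | hp p =>
    induction g using pathHom_induction with
    | h0 => simp
    | hadd x y hx hy => simp [hx, hy]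
    | hsmul r x hx => simp [hx]
    | hp q =>
      induction h using pathHom_induction with
      | h0 => simp
      | hadd x y hx hy => simp only [map_add, hx, hy]
      | hsmul r x hx => simp only [map_smul, hx]
      | hp s => simp

/-- `x ⊗ y ↦ f x ⊗ y`, i.e. multiplication by `f ⊗ 1` from the left. -/
def mulLL {a b c d e : V} (f : PathHom K a b) :
    PathHom K b c ⊗[K] PathHom K d e →ₗ[K] PathHom K a c ⊗[K] PathHom K d e :=
  (concat f).rTensor _

/-- `x ⊗ y ↦ x ⊗ f y`, i.e. multiplication by `1 ⊗ f` from the left. -/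
def mulLR {a b c d e : V} (f : PathHom K d e) :
    PathHom K a b ⊗[K] PathHom K e c →ₗ[K] PathHom K a b ⊗[K] PathHom K d c :=
  (concat f).lTensor _

/-- `x ⊗ y ↦ x f ⊗ y`, i.e. multiplication by `f ⊗ 1` from the right. -/
def mulRL {a b c d e : V} (f : PathHom K b c) :
    PathHom K a b ⊗[K] PathHom K d e →ₗ[K] PathHom K a c ⊗[K] PathHom K d e :=
  (concat.flip f).rTensor _

/-- `x ⊗ y ↦ x ⊗ y f`, i.e. multiplication by `1 ⊗ f` from the right. -/
def mulRR {a b c d e : V} (f : PathHom K d e) :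
    PathHom K a b ⊗[K] PathHom K c d →ₗ[K] PathHom K a b ⊗[K] PathHom K c e :=
  (concat.flip f).lTensor _

/-! ### The double bracket generated by brackets of arrows -/

/-- Prescribed double brackets `{{e, f}} ∈ Hom(c,b) ⊗ Hom(a,d)` for arrows `e : a → b` and
`f : c → d`. -/
abbrev ArrowBracket (K : Type*) [Field K] (V : Type*) [Quiver V] : Type _ :=
  ∀ ⦃a b c d : V⦄, (a ⟶ b) → (c ⟶ d) → PathHom K c b ⊗[K] PathHom K a d

/-- Extension in the second argument by `{{e, g h}} = (g ⊗ 1) {{e, h}} + {{e, g}} (1 ⊗ h)`. -/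
def arrowPathBracket (β : ArrowBracket K V) {a b : V} (e : a ⟶ b) :
    {c d : V} → Quiver.Path c d → PathHom K c b ⊗[K] PathHom K a d
  | _, _, .nil => 0
  | _, _, .cons g h =>
      mulLL (ofPath K g) (β e h) + mulRR (ofPath K h.toPath) (arrowPathBracket β e g)

/-- Extension in the first argument by `{{f g, h}} = (1 ⊗ f) {{g, h}} + {{f, h}} (g ⊗ 1)`. -/
def pathPathBracket (β : ArrowBracket K V) {a : V} :
    {b c d : V} → Quiver.Path a b → Quiver.Path c d → PathHom K c b ⊗[K] PathHom K a d
  | _, _, _, .nil, _ => 0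
  | _, _, _, .cons f g, h =>
      mulLR (ofPath K f) (arrowPathBracket β g h) +
        mulRL (ofPath K g.toPath) (pathPathBracket β f h)

/-- The double bracket on the path category: the bilinear extension, obeying both double
Leibniz identities (`doubleBracket_concat_left`, `doubleBracket_concat_right`), of the
prescribed brackets of arrows. -/
def doubleBracket (β : ArrowBracket K V) {a b c d : V} :
    PathHom K a b →ₗ[K] PathHom K c d →ₗ[K] PathHom K c b ⊗[K] PathHom K a d :=
  Finsupp.linearCombination K fun p =>
    Finsupp.linearCombination K fun q => pathPathBracket β p q

@[simp]
theorem doubleBracket_ofPath (β : ArrowBracket K V) {a b c d : V}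
    (p : Quiver.Path a b) (q : Quiver.Path c d) :
    doubleBracket β (ofPath K p) (ofPath K q) = pathPathBracket β p q := by
  simp [doubleBracket, ofPath]

theorem mulLR_comp {a b c d e f : V} (x : PathHom K d e) (y : PathHom K e f)
    (t : PathHom K a b ⊗[K] PathHom K f c) : mulLR x (mulLR y t) = mulLR (concat x y) t := by
  induction t using TensorProduct.induction_on with
  | zero => simp
  | tmul u v => simp [mulLR, concat_assoc]
  | add s t hs ht => simp [hs, ht]

theorem mulRL_comp {a b c d e f : V} (x : PathHom K b c) (y : PathHom K c f)
    (t : PathHom K a b ⊗[K] PathHom K d e) : mulRL y (mulRL x t) = mulRL (concat x y) t := by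
  induction t using TensorProduct.induction_on with
  | zero => simp
  | tmul u v => simp [mulRL, concat_assoc]
  | add s t hs ht => simp [hs, ht]

theorem mulLL_comp {a b c d e f : V} (x : PathHom K f a) (y : PathHom K a b)
    (t : PathHom K b c ⊗[K] PathHom K d e) : mulLL x (mulLL y t) = mulLL (concat x y) t := by
  induction t using TensorProduct.induction_on with
  | zero => simp
  | tmul u v => simp [mulLL, concat_assoc]
  | add s t hs ht => simp [hs, ht]

theorem mulRR_comp {a b c d e f : V} (x : PathHom K d e) (y : PathHom K e f)
    (t : PathHom K a b ⊗[K] PathHom K c d) : mulRR y (mulRR x t) = mulRR (concat x y) t := by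
  induction t using TensorProduct.induction_on with
  | zero => simp
  | tmul u v => simp [mulRR, concat_assoc]
  | add s t hs ht => simp [hs, ht]

theorem mulLR_mulRL {a b c d e f : V} (x : PathHom K d e) (y : PathHom K b c)
    (t : PathHom K a b ⊗[K] PathHom K e f) : mulLR x (mulRL y t) = mulRL y (mulLR x t) := by
  induction t using TensorProduct.induction_on with
  | zero => simp
  | tmul u v => simp [mulLR, mulRL]
  | add s t hs ht => simp [hs, ht]

theorem mulLL_mulRR {a b c d e f : V} (x : PathHom K a b) (y : PathHom K e f)
    (t : PathHom K b c ⊗[K] PathHom K d e) : mulLL x (mulRR y t) = mulRR y (mulLL x t) := by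
  induction t using TensorProduct.induction_on with
  | zero => simp
  | tmul u v => simp [mulLL, mulRR]
  | add s t hs ht => simp [hs, ht]

theorem mulLR_mulLL {a b c d e f : V} (x : PathHom K d e) (y : PathHom K a b)
    (t : PathHom K b c ⊗[K] PathHom K e f) : mulLR x (mulLL y t) = mulLL y (mulLR x t) := by
  induction t using TensorProduct.induction_on with
  | zero => simp
  | tmul u v => simp [mulLL, mulLR]
  | add s t hs ht => simp [hs, ht]

theorem mulLR_mulRR {a b c d e f : V} (x : PathHom K c d) (y : PathHom K e f)
    (t : PathHom K a b ⊗[K] PathHom K d e) : mulLR x (mulRR y t) = mulRR y (mulLR x t) := by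
  induction t using TensorProduct.induction_on with
  | zero => simp
  | tmul u v => simp [mulRR, mulLR, concat_assoc]
  | add s t hs ht => simp [hs, ht]

theorem mulRL_mulLL {a b c d e f : V} (x : PathHom K c f) (y : PathHom K a b)
    (t : PathHom K b c ⊗[K] PathHom K d e) : mulRL x (mulLL y t) = mulLL y (mulRL x t) := by
  induction t using TensorProduct.induction_on with
  | zero => simp
  | tmul u v => simp [mulLL, mulRL, concat_assoc]
  | add s t hs ht => simp [hs, ht]

theorem mulRL_mulRR {a b c d e f : V} (x : PathHom K b c) (y : PathHom K e f)
    (t : PathHom K a b ⊗[K] PathHom K d e) : mulRL x (mulRR y t) = mulRR y (mulRL x t) := by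
  induction t using TensorProduct.induction_on with
  | zero => simp
  | tmul u v => simp [mulRR, mulRL]
  | add s t hs ht => simp [hs, ht]

theorem mulLR_nil {a b c d : V} (t : PathHom K a b ⊗[K] PathHom K c d) :
    mulLR (ofPath K (.nil : Quiver.Path c c)) t = t := by
  have h : (concat (ofPath K (.nil : Quiver.Path c c)) : PathHom K c d →ₗ[K] _) = .id :=
    pathHom_ext fun p => by simp
  simp [mulLR, h]

theorem mulLL_nil {a b c d : V} (t : PathHom K a b ⊗[K] PathHom K c d) :
    mulLL (ofPath K (.nil : Quiver.Path a a)) t = t := by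
  have h : (concat (ofPath K (.nil : Quiver.Path a a)) : PathHom K a b →ₗ[K] _) = .id :=
    pathHom_ext fun p => by simp
  simp [mulLL, h]

theorem mulRR_nil {a b c d : V} (t : PathHom K a b ⊗[K] PathHom K c d) :
    mulRR (ofPath K (.nil : Quiver.Path d d)) t = t := by
  have h : (concat.flip (ofPath K (.nil : Quiver.Path d d)) : PathHom K c d →ₗ[K] _) = .id :=
    pathHom_ext fun p => by simp
  simp [mulRR, h]

theorem mulRL_nil {a b c d : V} (t : PathHom K a b ⊗[K] PathHom K c d) :
    mulRL (ofPath K (.nil : Quiver.Path b b)) t = t := by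
  have h : (concat.flip (ofPath K (.nil : Quiver.Path b b)) : PathHom K a b →ₗ[K] _) = .id :=
    pathHom_ext fun p => by simp
  simp [mulRL, h]

theorem arrowPathBracket_comp (β : ArrowBracket K V) {a b : V} (e : a ⟶ b) {c d d' : V}
    (g : Quiver.Path c d) (h : Quiver.Path d d') :
    arrowPathBracket β e (g.comp h) =
      mulLL (ofPath K g) (arrowPathBracket β e h) +
        mulRR (ofPath K h) (arrowPathBracket β e g) := by
  induction h with
  | nil => simp [arrowPathBracket, mulRR_nil]
  | cons h k ih =>
    have hk : ofPath K (h.cons k) = ofPath K (h.comp k.toPath) := rfl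
    simp only [Quiver.Path.comp_cons, arrowPathBracket, ih, map_add, mulLL_comp, concat_ofPath,
      hk, mulRR_comp, mulLL_mulRR]
    abel

theorem pathPathBracket_comp_left (β : ArrowBracket K V) {a b b' c d : V}
    (f : Quiver.Path a b) (g : Quiver.Path b b') (h : Quiver.Path c d) :
    pathPathBracket β (f.comp g) h =
      mulLR (ofPath K f) (pathPathBracket β g h) +
        mulRL (ofPath K g) (pathPathBracket β f h) := by
  induction g with
  | nil => simp [pathPathBracket, mulRL_nil]
  | cons g k ih =>
    have hk : ofPath K (g.cons k) = ofPath K (g.comp k.toPath) := rfl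
    simp only [Quiver.Path.comp_cons, pathPathBracket, ih, map_add, mulLR_comp, concat_ofPath,
      hk, mulRL_comp, mulLR_mulRL]
    abel

theorem pathPathBracket_comp_right (β : ArrowBracket K V) {a b c d d' : V}
    (f : Quiver.Path a b) (g : Quiver.Path c d) (h : Quiver.Path d d') :
    pathPathBracket β f (g.comp h) =
      mulLL (ofPath K g) (pathPathBracket β f h) +
        mulRR (ofPath K h) (pathPathBracket β f g) := by
  induction f with
  | nil => simp [pathPathBracket]
  | cons f k ih =>
    simp only [pathPathBracket, ih, arrowPathBracket_comp, map_add, mulLR_mulLL, mulLR_mulRR,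
      mulRL_mulLL, mulRL_mulRR]
    abel

/-- First double Leibniz identity. -/
theorem doubleBracket_concat_left (β : ArrowBracket K V) {a b b' c d : V}
    (f : PathHom K a b) (g : PathHom K b b') (h : PathHom K c d) :
    doubleBracket β (concat f g) h =
      mulLR f (doubleBracket β g h) + mulRL g (doubleBracket β f h) := by
  induction h using pathHom_induction with
  | h0 => simp
  | hadd x y hx hy => simp only [map_add, hx, hy]; abel
  | hsmul r x hx => simp only [map_smul, hx, smul_add]
  | hp h =>
    induction f using pathHom_induction with
    | h0 => simp [mulLR]
    | hadd x y hx hy =>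
      simp only [map_add, LinearMap.add_apply, hx, hy, mulLR, LinearMap.lTensor_add]; abel
    | hsmul r x hx =>
      simp only [map_smul, LinearMap.smul_apply, hx, smul_add, mulLR, LinearMap.lTensor_smul]
    | hp f =>
      induction g using pathHom_induction with
      | h0 => simp [mulRL]
      | hadd x y hx hy =>
        simp only [map_add, LinearMap.add_apply, hx, hy, mulRL, LinearMap.rTensor_add]; abel
      | hsmul r x hx =>
        simp only [map_smul, LinearMap.smul_apply, hx, smul_add, mulRL, LinearMap.rTensor_smul]
      | hp g => simp [pathPathBracket_comp_left]

/-- Second double Leibniz identity. -/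
theorem doubleBracket_concat_right (β : ArrowBracket K V) {a b c d d' : V}
    (f : PathHom K a b) (g : PathHom K c d) (h : PathHom K d d') :
    doubleBracket β f (concat g h) =
      mulLL g (doubleBracket β f h) + mulRR h (doubleBracket β f g) := by
  induction f using pathHom_induction with
  | h0 => simp
  | hadd x y hx hy => simp only [map_add, LinearMap.add_apply, hx, hy]; abel
  | hsmul r x hx => simp only [map_smul, LinearMap.smul_apply, hx, smul_add]
  | hp f =>
    induction g using pathHom_induction with
    | h0 => simp [mulLL]
    | hadd x y hx hy =>
      simp only [map_add, LinearMap.add_apply, hx, hy, mulLL, LinearMap.rTensor_add]; abel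
    | hsmul r x hx =>
      simp only [map_smul, LinearMap.smul_apply, hx, smul_add, mulLL, LinearMap.rTensor_smul]
    | hp g =>
      induction h using pathHom_induction with
      | h0 => simp [mulRR]
      | hadd x y hx hy =>
        simp only [map_add, LinearMap.add_apply, hx, hy, mulRR, LinearMap.lTensor_add]; abel
      | hsmul r x hx =>
        simp only [map_smul, LinearMap.smul_apply, hx, smul_add, mulRR, LinearMap.lTensor_smul]
      | hp h => simp [pathPathBracket_comp_right]

/-- The induced bracket `{f, h}`: concatenation applied to `{{f, h}}`, for a loop `f`. -/
def loopBracket (β : ArrowBracket K V) {a c d : V} :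
    PathHom K a a →ₗ[K] PathHom K c d →ₗ[K] PathHom K c d :=
  (doubleBracket β).compr₂ concatTensor

theorem concatTensor_mulLR {a b c d : V} (f : PathHom K b a)
    (t : PathHom K c b ⊗[K] PathHom K a d) :
    concatTensor (mulLR f t) = concatTensor (mulRL f t) := by
  induction t using TensorProduct.induction_on with
  | zero => simp
  | tmul u v => simp [mulLR, mulRL, concatTensor, concat_assoc]
  | add s t hs ht => simp [hs, ht]

theorem concatTensor_mulLL {a b c d : V} (f : PathHom K a b)
    (t : PathHom K b c ⊗[K] PathHom K c d) :
    concatTensor (mulLL f t) = concat f (concatTensor t) := by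
  induction t using TensorProduct.induction_on with
  | zero => simp
  | tmul u v => simp [mulLL, concatTensor, concat_assoc]
  | add s t hs ht => simp [hs, ht]

theorem concatTensor_mulRR {a b c d : V} (f : PathHom K c d)
    (t : PathHom K a b ⊗[K] PathHom K b c) :
    concatTensor (mulRR f t) = concat (concatTensor t) f := by
  induction t using TensorProduct.induction_on with
  | zero => simp
  | tmul u v => simp [mulRR, concatTensor, concat_assoc]
  | add s t hs ht => simp [hs, ht]

theorem loopBracket_cyclic (β : ArrowBracket K V) {a b c d : V}
    (f : PathHom K a b) (g : PathHom K b a) (h : PathHom K c d) :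
    loopBracket β (concat f g) h = loopBracket β (concat g f) h := by
  simp only [loopBracket, LinearMap.compr₂_apply, doubleBracket_concat_left, map_add,
    concatTensor_mulLR]
  abel

theorem loopBracket_concat (β : ArrowBracket K V) {a c d d' : V}
    (f : PathHom K a a) (g : PathHom K c d) (h : PathHom K d d') :
    loopBracket β f (concat g h) =
      concat g (loopBracket β f h) + concat (loopBracket β f g) h := by
  simp only [loopBracket, LinearMap.compr₂_apply, doubleBracket_concat_right, map_add,
    concatTensor_mulLL, concatTensor_mulRR]

end PathCategory

/-! ## The full subcategory on chosen objects: cyclic space, ideals, completion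

`obj : ι → V` selects the objects of a full subcategory `C` of the path category. -/

section Completion

variable {K : Type*} [Field K] {V : Type*} [Quiver V] {ι : Type*} (obj : ι → V)

/-- A linear combination of loops of `C` based at `i`, in the span of all loops. -/
def loopSpan (i : ι) : PathHom K (obj i) (obj i) →ₗ[K]
    ((Σ i, Quiver.Path (obj i) (obj i)) →₀ K) :=
  Finsupp.lmapDomain K K fun p => ⟨i, p⟩

/-- The span of all `f g - g f`, for `f g` a loop of `C`. -/
def commutators (K : Type*) [Field K] :
    Submodule K ((Σ i, Quiver.Path (obj i) (obj i)) →₀ K) :=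
  Submodule.span K {x | ∃ (i j : ι) (f : PathHom K (obj i) (obj j))
    (g : PathHom K (obj j) (obj i)),
    x = loopSpan obj i (concat f g) - loopSpan obj j (concat g f)}

/-- The cyclic space of `C`: linear combinations of loops modulo commutators. -/
def CyclicSpace (K : Type*) [Field K] : Type _ :=
  ((Σ i, Quiver.Path (obj i) (obj i)) →₀ K) ⧸ commutators obj K

instance : AddCommGroup (CyclicSpace obj K) :=
  inferInstanceAs (AddCommGroup (_ ⧸ commutators obj K))

instance : Module K (CyclicSpace obj K) :=
  inferInstanceAs (Module K (_ ⧸ commutators obj K))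

/-- The quotient map to the cyclic space. -/
def cycMk (K : Type*) [Field K] :
    ((Σ i, Quiver.Path (obj i) (obj i)) →₀ K) →ₗ[K] CyclicSpace obj K :=
  (commutators obj K).mkQ

theorem cycMk_surjective (K : Type*) [Field K] : Function.Surjective (cycMk obj K) :=
  Submodule.mkQ_surjective _

/-- The class of a loop in the cyclic space. -/
def cyc (i : ι) : PathHom K (obj i) (obj i) →ₗ[K] CyclicSpace obj K :=
  cycMk obj K ∘ₗ loopSpan obj i

theorem linearCombination_loopSpan (β : ArrowBracket K V) (c d i : ι)
    (f : PathHom K (obj i) (obj i)) :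
    Finsupp.linearCombination K (fun p : Σ i, Quiver.Path (obj i) (obj i) =>
      (loopBracket β (ofPath K p.2) : PathHom K (obj c) (obj d) →ₗ[K] _)) (loopSpan obj i f) =
      loopBracket β f := by
  induction f using pathHom_induction with
  | h0 => simp
  | hadd x y hx hy => simp only [map_add, hx, hy]
  | hsmul r x hx => simp only [map_smul, hx]
  | hp p => simp [loopSpan, ofPath]

/-- The bracket `{-,-}` of the cyclic space with `C`, induced by the double bracket. -/
def cyclicBracket (β : ArrowBracket K V) (c d : ι) :
    CyclicSpace obj K →ₗ[K]
      PathHom K (obj c) (obj d) →ₗ[K] PathHom K (obj c) (obj d) :=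
  (commutators obj K).liftQ
    (Finsupp.linearCombination K fun p => loopBracket β (ofPath K p.2)) <| by
    rw [commutators, Submodule.span_le]
    rintro _ ⟨i, j, f, g, rfl⟩
    simp only [SetLike.mem_coe, LinearMap.mem_ker, map_sub, linearCombination_loopSpan]
    rw [sub_eq_zero]
    exact LinearMap.ext fun h => loopBracket_cyclic β f g h

theorem cyclicBracket_cyc (β : ArrowBracket K V) (c d i : ι)
    (f : PathHom K (obj i) (obj i)) :
    cyclicBracket obj β c d (cyc obj i f) = loopBracket β f :=
  linearCombination_loopSpan obj β c d i f

/-- A two-sided ideal of the `K`-linear category `C`. -/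
structure PathIdeal (K : Type*) [Field K] {V : Type*} [Quiver V] {ι : Type*} (obj : ι → V) where
  /-- The morphisms belonging to the ideal. -/
  carrier : ∀ i j : ι, Submodule K (PathHom K (obj i) (obj j))
  concat_left_mem : ∀ {i j k : ι} (f : PathHom K (obj i) (obj j)) {g : PathHom K (obj j) (obj k)},
    g ∈ carrier j k → concat f g ∈ carrier i k
  concat_right_mem : ∀ {i j k : ι} {f : PathHom K (obj i) (obj j)}
    (g : PathHom K (obj j) (obj k)), f ∈ carrier i j → concat f g ∈ carrier i k

namespace PathIdeal

variable {obj} (J : PathIdeal K obj)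

/-- The powers `J ^ m` of an ideal, with `J ^ 0` the whole category. -/
def pow : ℕ → ∀ i j : ι, Submodule K (PathHom K (obj i) (obj j))
  | 0, _, _ => ⊤
  | m + 1, i, j => Submodule.span K {x | ∃ (k : ι), ∃ f ∈ J.carrier i k,
      ∃ g ∈ pow m k j, x = concat f g}

theorem concat_mem_pow_succ {m : ℕ} {i j k : ι} {f : PathHom K (obj i) (obj j)}
    {g : PathHom K (obj j) (obj k)} (hf : f ∈ J.carrier i j) (hg : g ∈ J.pow m j k) :
    concat f g ∈ J.pow (m + 1) i k :=
  Submodule.subset_span ⟨j, f, hf, g, hg, rfl⟩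

theorem pow_induction {m : ℕ} {i j : ι} {P : PathHom K (obj i) (obj j) → Prop}
    {x : PathHom K (obj i) (obj j)} (hx : x ∈ J.pow (m + 1) i j)
    (h : ∀ (k : ι), ∀ f ∈ J.carrier i k, ∀ g ∈ J.pow m k j, P (concat f g))
    (h0 : P 0) (hadd : ∀ x y, P x → P y → P (x + y))
    (hsmul : ∀ (r : K) x, P x → P (r • x)) : P x := by
  refine Submodule.span_induction (p := fun x _ => P x) ?_ h0 (fun x y _ _ => hadd x y)
    (fun r x _ => hsmul r x) hx
  rintro _ ⟨k, f, hf, g, hg, rfl⟩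
  exact h k f hf g hg

theorem pow_concat_left {m : ℕ} {i j k : ι} (f : PathHom K (obj i) (obj j))
    {g : PathHom K (obj j) (obj k)} (hg : g ∈ J.pow m j k) : concat f g ∈ J.pow m i k := by
  cases m with
  | zero => trivial
  | succ m =>
    refine J.pow_induction (P := fun y => concat f y ∈ J.pow (m + 1) i k) hg ?_ (by simp) (fun x y hx hy => ?_) (fun r x hx => ?_)
    · intro l u hu v hv
      rw [← concat_assoc]
      exact J.concat_mem_pow_succ (J.concat_left_mem f hu) hv
    · rw [map_add]; exact add_mem hx hy
    · rw [map_smul]; exact Submodule.smul_mem _ _ hx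

theorem pow_mul_pow {m n : ℕ} {i j k : ι} {f : PathHom K (obj i) (obj j)}
    {g : PathHom K (obj j) (obj k)} (hf : f ∈ J.pow m i j) (hg : g ∈ J.pow n j k) :
    concat f g ∈ J.pow (m + n) i k := by
  induction m generalizing i with
  | zero => simpa using J.pow_concat_left f hg
  | succ m ih =>
    refine J.pow_induction (P := fun x => concat x g ∈ J.pow (m + 1 + n) i k) hf ?_ (by simp)
      (fun x y hx hy => ?_) (fun r x hx => ?_)
    · intro l u hu v hv
      rw [concat_assoc, Nat.succ_add]
      exact J.concat_mem_pow_succ hu (ih hv)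
    · rw [map_add, LinearMap.add_apply]; exact add_mem hx hy
    · rw [map_smul, LinearMap.smul_apply]; exact Submodule.smul_mem _ _ hx

theorem pow_concat_right {m : ℕ} {i j k : ι} {f : PathHom K (obj i) (obj j)}
    (g : PathHom K (obj j) (obj k)) (hf : f ∈ J.pow m i j) : concat f g ∈ J.pow m i k :=
  J.pow_mul_pow (n := 0) hf trivial

theorem pow_succ_le (m : ℕ) (i j : ι) : J.pow (m + 1) i j ≤ J.pow m i j := by
  intro x hx
  refine J.pow_induction hx ?_ (zero_mem _) (fun _ _ => add_mem)
    (fun r _ => Submodule.smul_mem _ r)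
  intro k f _ g hg
  exact J.pow_concat_left f hg

theorem pow_antitone {m n : ℕ} (h : m ≤ n) (i j : ι) : J.pow n i j ≤ J.pow m i j := by
  induction h with
  | refl => exact le_rfl
  | step _ ih => exact (J.pow_succ_le _ i j).trans ih

/-- The filtration of `C ⊗ C` by total degree. -/
def tensorPow (m : ℕ) (i j k l : ι) :
    Submodule K (PathHom K (obj i) (obj j) ⊗[K] PathHom K (obj k) (obj l)) :=
  Submodule.span K {t | ∃ p q, m ≤ p + q ∧ ∃ x ∈ J.pow p i j, ∃ y ∈ J.pow q k l, t = x ⊗ₜ[K] y}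

theorem doubleBracket_mem_tensorPow (β : ArrowBracket K V) {m : ℕ} {i j k l : ι}
    {f : PathHom K (obj i) (obj j)} (hf : f ∈ J.pow (m + 1) i j)
    (h : PathHom K (obj k) (obj l)) : doubleBracket β f h ∈ J.tensorPow m k j i l := by
  induction m generalizing i with
  | zero =>
    refine (?_ : J.tensorPow 0 k j i l = ⊤) ▸ Submodule.mem_top
    rw [eq_top_iff, ← TensorProduct.span_tmul_eq_top]
    refine Submodule.span_mono ?_
    rintro _ ⟨x, y, rfl⟩
    exact ⟨0, 0, le_rfl, x, trivial, y, trivial, rfl⟩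
  | succ m ih =>
    refine J.pow_induction (P := fun x => doubleBracket β x h ∈ J.tensorPow (m + 1) k j i l) hf ?_
      (by simp) (fun x y hx hy => ?_) (fun r x hx => ?_)
    · intro n u hu v hv
      rw [doubleBracket_concat_left]
      refine add_mem ?_ ?_
      · refine Submodule.span_induction (p := fun t _ => mulLR u t ∈ J.tensorPow (m + 1) k j i l)
          ?_ (by simp) (fun x y _ _ hx hy => ?_) (fun r x _ hx => ?_) (ih hv)
        · rintro _ ⟨p, q, hpq, x, hx, y, hy, rfl⟩
          exact Submodule.subset_span
            ⟨p, q + 1, by omega, x, hx, concat u y, J.concat_mem_pow_succ hu hy, rfl⟩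
        · rw [map_add]; exact add_mem hx hy
        · rw [map_smul]; exact Submodule.smul_mem _ _ hx
      · induction doubleBracket β u h using TensorProduct.induction_on with
        | zero => simp
        | add s t hs ht => rw [map_add]; exact add_mem hs ht
        | tmul x y =>
          exact Submodule.subset_span
            ⟨m + 1, 0, le_rfl, concat x v, J.pow_concat_left x hv, y, trivial, rfl⟩
    · rw [map_add, LinearMap.add_apply]; exact add_mem hx hy
    · rw [map_smul, LinearMap.smul_apply]; exact Submodule.smul_mem _ _ hx

theorem loopBracket_mem_left (β : ArrowBracket K V) {m : ℕ} {i k l : ι}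
    {f : PathHom K (obj i) (obj i)} (hf : f ∈ J.pow (m + 1) i i)
    (h : PathHom K (obj k) (obj l)) : loopBracket β f h ∈ J.pow m k l := by
  rw [loopBracket, LinearMap.compr₂_apply]
  refine Submodule.span_induction (p := fun t _ => concatTensor t ∈ J.pow m k l)
    ?_ (by simp) (fun x y _ _ hx hy => ?_) (fun r x _ hx => ?_)
    (J.doubleBracket_mem_tensorPow β hf h)
  · rintro _ ⟨p, q, hpq, x, hx, y, hy, rfl⟩
    exact J.pow_antitone hpq _ _ (J.pow_mul_pow hx hy)
  · rw [map_add]; exact add_mem hx hy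
  · rw [map_smul]; exact Submodule.smul_mem _ _ hx

theorem loopBracket_mem_right (β : ArrowBracket K V) {m : ℕ} {i k l : ι}
    (f : PathHom K (obj i) (obj i)) {h : PathHom K (obj k) (obj l)}
    (hh : h ∈ J.pow (m + 1) k l) : loopBracket β f h ∈ J.pow m k l := by
  induction m generalizing k with
  | zero => trivial
  | succ m ih =>
    refine J.pow_induction (P := fun y => loopBracket β f y ∈ J.pow (m + 1) k l) hh ?_ (by simp)
      (fun x y hx hy => ?_) (fun r x hx => ?_)
    · intro n u hu v hv
      rw [loopBracket_concat]
      exact add_mem (J.concat_mem_pow_succ hu (ih hv)) (J.pow_concat_left _ hv)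
    · rw [map_add]; exact add_mem hx hy
    · rw [map_smul]; exact Submodule.smul_mem _ _ hx

/-! ### The completed category -/

/-- `Hom(i,j)` in the completed category `Ĉ`: the inverse limit of `Hom(i,j) / J^m(i,j)`. When `C`
is graded with `J^m` the span of the homogeneous elements of degree at least `m`, this is the
product of the homogeneous components, i.e. the space of formal power series. -/
def completion (i j : ι) : Submodule K (∀ m : ℕ, PathHom K (obj i) (obj j) ⧸ J.pow m i j) where
  carrier := {x | ∀ m, Submodule.factor (J.pow_succ_le m i j) (x (m + 1)) = x m}
  add_mem' hx hy m := by simp [hx m, hy m]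
  zero_mem' m := by simp
  smul_mem' r x hx m := by simp [hx m]

instance (i j : ι) : AddCommGroup (J.completion i j) := Module.addCommMonoidToAddCommGroup K

/-- The canonical map `C → Ĉ`. -/
def toCompletion (i j : ι) : PathHom K (obj i) (obj j) →ₗ[K] J.completion i j where
  toFun f := ⟨fun m => (J.pow m i j).mkQ f, fun m => by simp⟩
  map_add' f g := rfl
  map_smul' r f := rfl

/-- Concatenation modulo `J ^ m`. -/
def concatMod (m : ℕ) (i j k : ι) :
    (PathHom K (obj i) (obj j) ⧸ J.pow m i j) →ₗ[K]
      (PathHom K (obj j) (obj k) ⧸ J.pow m j k) →ₗ[K]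
        (PathHom K (obj i) (obj k) ⧸ J.pow m i k) :=
  (J.pow m i j).liftQ
    (LinearMap.flip <| (J.pow m j k).liftQ (concat.compr₂ (J.pow m i k).mkQ).flip <| by
      intro g hg
      refine LinearMap.mem_ker.2 (LinearMap.ext fun f => ?_)
      simpa using J.pow_concat_left f hg) <| by
    intro f hf
    refine LinearMap.mem_ker.2 (LinearMap.ext fun g => ?_)
    obtain ⟨g, rfl⟩ := Submodule.mkQ_surjective _ g
    simpa using J.pow_concat_right g hf

theorem concatMod_mk (m : ℕ) (i j k : ι) (f : PathHom K (obj i) (obj j))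
    (g : PathHom K (obj j) (obj k)) :
    J.concatMod m i j k ((J.pow m i j).mkQ f) ((J.pow m j k).mkQ g) =
      (J.pow m i k).mkQ (concat f g) := rfl

/-- Concatenation in `Ĉ`. -/
def hatConcat {i j k : ι} (x : J.completion i j) (y : J.completion j k) : J.completion i k :=
  ⟨fun m => J.concatMod m i j k (x.1 m) (y.1 m), fun m => by
    beta_reduce
    rw [← x.2 m, ← y.2 m]
    obtain ⟨f, hf⟩ := Submodule.mkQ_surjective _ (x.1 (m + 1))
    obtain ⟨g, hg⟩ := Submodule.mkQ_surjective _ (y.1 (m + 1))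
    rw [← hf, ← hg]
    rfl⟩

/-- The filtration of the cyclic space by the classes of loops in `J ^ m`. -/
def cyclicPow (m : ℕ) : Submodule K (CyclicSpace obj K) :=
  ⨆ i, (J.pow m i i).map (cyc obj i)

theorem cyclicPow_succ_le (m : ℕ) : J.cyclicPow (m + 1) ≤ J.cyclicPow m :=
  iSup_mono fun i => Submodule.map_mono (J.pow_succ_le m i i)

/-- The completed cyclic space. -/
def cyclicCompletion :
    Submodule K (∀ m : ℕ, CyclicSpace obj K ⧸ J.cyclicPow m) where
  carrier := {x | ∀ m, Submodule.factor (J.cyclicPow_succ_le m) (x (m + 1)) = x m}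
  add_mem' hx hy m := by simp [hx m, hy m]
  zero_mem' m := by simp
  smul_mem' r x hx m := by simp [hx m]

/-- The class in the completed cyclic space of a loop of `Ĉ`. -/
def hatCyc (i : ι) (x : J.completion i i) : J.cyclicCompletion :=
  ⟨fun m => (J.pow m i i).mapQ (J.cyclicPow m) (cyc obj i)
      (Submodule.map_le_iff_le_comap.1 (le_iSup (fun i => (J.pow m i i).map (cyc obj i)) i))
      (x.1 m), fun m => by
    beta_reduce
    rw [← x.2 m]
    obtain ⟨f, hf⟩ := Submodule.mkQ_surjective _ (x.1 (m + 1))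
    rw [← hf]
    rfl⟩

theorem cyclicBracket_mem_left (β : ArrowBracket K V) {m : ℕ} {k l : ι}
    {x : CyclicSpace obj K} (hx : x ∈ J.cyclicPow (m + 1)) (h : PathHom K (obj k) (obj l)) :
    cyclicBracket obj β k l x h ∈ J.pow m k l := by
  have : J.cyclicPow (m + 1) ≤
      (J.pow m k l).comap ((cyclicBracket obj β k l).flip h) := by
    refine iSup_le fun i => ?_
    rw [Submodule.map_le_iff_le_comap]
    intro f hf
    simpa [cyclicBracket_cyc] using J.loopBracket_mem_left β hf h
  exact this hx

theorem cyclicBracket_mem_right (β : ArrowBracket K V) {m : ℕ} {k l : ι}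
    (x : CyclicSpace obj K) {h : PathHom K (obj k) (obj l)} (hh : h ∈ J.pow (m + 1) k l) :
    cyclicBracket obj β k l x h ∈ J.pow m k l := by
  obtain ⟨x, rfl⟩ := cycMk_surjective obj K x
  induction x using Finsupp.induction_linear with
  | zero => simp
  | add x y hx hy => rw [map_add, map_add, LinearMap.add_apply]; exact add_mem hx hy
  | single p r =>
    have h1 : cycMk obj K (Finsupp.single p r) = r • cyc obj p.1 (ofPath K p.2) := by
      rw [cyc, LinearMap.comp_apply, ← map_smul]
      simp [loopSpan, ofPath]
    rw [h1, map_smul, LinearMap.smul_apply, cyclicBracket_cyc]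
    exact Submodule.smul_mem _ _ (J.loopBracket_mem_right β _ hh)

/-- The bracket lowers the filtration by at most one, hence descends to a map from classes
modulo `J ^ (m + 1)` to classes modulo `J ^ m`. -/
def bracketMod (β : ArrowBracket K V) (m : ℕ) (k l : ι) :
    (CyclicSpace obj K ⧸ J.cyclicPow (m + 1)) →ₗ[K]
      (PathHom K (obj k) (obj l) ⧸ J.pow (m + 1) k l) →ₗ[K]
        (PathHom K (obj k) (obj l) ⧸ J.pow m k l) :=
  (J.cyclicPow (m + 1)).liftQ
    (LinearMap.flip <| (J.pow (m + 1) k l).liftQ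
      ((cyclicBracket obj β k l).compr₂ (J.pow m k l).mkQ).flip <| by
      intro h hh
      refine LinearMap.mem_ker.2 (LinearMap.ext fun x => ?_)
      simpa using J.cyclicBracket_mem_right β x hh) <| by
    intro x hx
    refine LinearMap.mem_ker.2 (LinearMap.ext fun h => ?_)
    obtain ⟨h, rfl⟩ := Submodule.mkQ_surjective _ h
    simpa using J.cyclicBracket_mem_left β hx h

/-- The bracket `{-,-}` of the completed cyclic space with `Ĉ`: the continuous extension of
`cyclicBracket`. -/
def hatBracket (β : ArrowBracket K V) {k l : ι}
    (x : J.cyclicCompletion) (y : J.completion k l) : J.completion k l :=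
  ⟨fun m => J.bracketMod β m k l (x.1 (m + 1)) (y.1 (m + 1)), fun m => by
    beta_reduce
    rw [← x.2 (m + 1), ← y.2 (m + 1)]
    obtain ⟨f, hf⟩ := Submodule.mkQ_surjective _ (x.1 (m + 1 + 1))
    obtain ⟨g, hg⟩ := Submodule.mkQ_surjective _ (y.1 (m + 1 + 1))
    rw [← hf, ← hg]
    rfl⟩

end PathIdeal

/-! ### Matrices -/

/-- Square matrices over `C`, with `(i,j)` entry in `Hom(i,j)`. -/
abbrev PathMatrix (K : Type*) [Field K] {V : Type*} [Quiver V] {ι : Type*} (obj : ι → V) : Type _ :=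
  ∀ i j : ι, PathHom K (obj i) (obj j)

/-- The identity matrix: identity morphisms on the diagonal, zero elsewhere. -/
def identityMatrix (K : Type*) [Field K] [DecidableEq ι] : PathMatrix K obj := fun i j =>
  if h : i = j then h ▸ ofPath K (.nil : Quiver.Path (obj i) (obj i)) else 0

variable {obj} [Fintype ι]

/-- Powers of a matrix over `C`. -/
def matrixPow [DecidableEq ι] (X : PathMatrix K obj) : ℕ → PathMatrix K obj
  | 0 => identityMatrix obj K
  | n + 1 => fun i j => ∑ k, concat (X i k) (matrixPow X n k j)

namespace PathIdeal

variable (J : PathIdeal K obj)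

theorem matrixPow_mem [DecidableEq ι] {X : PathMatrix K obj} (hX : ∀ i j, X i j ∈ J.carrier i j)
    (n : ℕ) (i j : ι) : matrixPow X n i j ∈ J.pow n i j := by
  induction n generalizing i j with
  | zero => trivial
  | succ n ih => exact Submodule.sum_mem _ fun k _ => J.concat_mem_pow_succ (hX i k) (ih k j)

/-- Square matrices over `Ĉ`. -/
abbrev HatMatrix : Type _ := ∀ i j : ι, J.completion i j

/-- Product of matrices over `Ĉ`. -/
def hatMul (A B : J.HatMatrix) : J.HatMatrix := fun i j => ∑ k, J.hatConcat (A i k) (B k j)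

/-- The sum `∑ cₙ Xⁿ` in the completed category, for a matrix `X` with entries in `J`: its image
modulo `J ^ m` is `∑_{n < m} cₙ Xⁿ`, as `Xⁿ` vanishes modulo `J ^ m` for `n ≥ m`. -/
def powerSeries [DecidableEq ι] (coeff : ℕ → K) (X : PathMatrix K obj)
    (hX : ∀ i j, X i j ∈ J.carrier i j) : J.HatMatrix := fun i j =>
  ⟨fun m => (J.pow m i j).mkQ (∑ n ∈ Finset.range m, coeff n • matrixPow X n i j), fun m => by
    beta_reduce
    rw [Submodule.factor_mk, Finset.sum_range_succ, map_add,
      add_eq_left, Submodule.mkQ_apply, Submodule.Quotient.mk_eq_zero]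
    exact Submodule.smul_mem _ _ (J.matrixPow_mem hX m i j)⟩

/-- The logarithm `log B = log (1 + X) = ∑_{n ≥ 1} (-1)^(n+1) Xⁿ / n` of a matrix `1 + X` with the entries
of `X` in `J`. -/
def logOneAdd [DecidableEq ι] (X : PathMatrix K obj) (hX : ∀ i j, X i j ∈ J.carrier i j) :
    J.HatMatrix :=
  J.powerSeries (fun n => if n = 0 then 0 else (-1) ^ (n + 1) / (n : K)) X hX

/-- The class of the trace of a matrix in the completed cyclic space. -/
def hatTrace (A : J.HatMatrix) : J.cyclicCompletion := ∑ i, J.hatCyc i (A i i)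

end PathIdeal

end Completion

/-! ## Perfect networks on a cylinder -/

/-- A finite perfect directed graph with `m` univalent sources and `n` univalent sinks, whose
internal vertices are trivalent, each being white (one incoming and two outgoing edges) or black
(two incoming and one outgoing edge), together with a cyclic order of the edges at each
internal vertex. Every edge starts at exactly one outgoing half-edge and ends at exactly one incoming
half-edge. At a white vertex `w` the outgoing half-edges `(w, false)`, `(w, true)` and the
incoming one are in counter-clockwise order; at a black vertex `b` the incoming half-edges
`(b, false)`, `(b, true)` and the outgoing one are in counter-clockwise order. -/
structure PerfectNetwork (m n : ℕ) where
  White : Type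
  Black : Type
  Edge : Type
  [fintypeWhite : Fintype White]
  [fintypeBlack : Fintype Black]
  [fintypeEdge : Fintype Edge]
  /-- The half-edge at which an edge starts: a source, one of the two outgoing half-edges of a
  white vertex, or the outgoing half-edge of a black vertex. -/
  start : Edge ≃ Fin m ⊕ (White × Bool) ⊕ Black
  /-- The half-edge at which an edge ends: a sink, the incoming half-edge of a white vertex, or one
  of the two incoming half-edges of a black vertex. -/
  finish : Edge ≃ Fin n ⊕ White ⊕ (Black × Bool)

attribute [instance] PerfectNetwork.fintypeWhite PerfectNetwork.fintypeBlack
  PerfectNetwork.fintypeEdge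

namespace PerfectNetwork

variable {m n : ℕ} (Γ : PerfectNetwork m n)

/-- The vertices: sources, internal vertices, sinks. -/
inductive Vertex : Type
  | source (i : Fin m)
  | white (w : Γ.White)
  | black (b : Γ.Black)
  | sink (j : Fin n)

/-- The vertex at which an edge starts. -/
def src (e : Γ.Edge) : Γ.Vertex :=
  match Γ.start e with
  | .inl i => .source i
  | .inr (.inl (w, _)) => .white w
  | .inr (.inr b) => .black b

/-- The vertex at which an edge ends. -/
def tgt (e : Γ.Edge) : Γ.Vertex :=
  match Γ.finish e with
  | .inl j => .sink j
  | .inr (.inl w) => .white w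
  | .inr (.inr (b, _)) => .black b

instance : Quiver Γ.Vertex := ⟨fun u v => {e : Γ.Edge // Γ.src e = u ∧ Γ.tgt e = v}⟩

/-- There are no oriented cycles. -/
def IsAcyclic : Prop := ∀ (v : Γ.Vertex) (p : Quiver.Path v v), p.length = 0

/-- The ends of edges: `inl e` is the initial and `inr e` the terminal end of `e`. -/
abbrev Dart : Type := Γ.Edge ⊕ Γ.Edge

/-- Draw the cylinder as a rectangle with top and bottom identified, the sources numbered
from top to bottom on the left edge and the sinks from top to bottom on the right edge, and
contract either boundary circle to a point, so that the graph lies on a sphere. `rotate` sends an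
end of an edge to the next one in counter-clockwise order around its vertex of that
spherical graph. -/
def rotate : Γ.Dart → Γ.Dart
  | .inl e => match Γ.start e with
    | .inl i => .inl (Γ.start.symm (.inl ((finRotate m).symm i)))
    | .inr (.inl (w, false)) => .inl (Γ.start.symm (.inr (.inl (w, true))))
    | .inr (.inl (w, true)) => .inr (Γ.finish.symm (.inr (.inl w)))
    | .inr (.inr b) => .inr (Γ.finish.symm (.inr (.inr (b, false))))
  | .inr e => match Γ.finish e with
    | .inl j => .inr (Γ.finish.symm (.inl (finRotate n j)))
    | .inr (.inl w) => .inl (Γ.start.symm (.inr (.inl (w, false))))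
    | .inr (.inr (b, false)) => .inr (Γ.finish.symm (.inr (.inr (b, true))))
    | .inr (.inr (b, true)) => .inl (Γ.start.symm (.inr (.inr b)))

/-- One step of the walk around a face of the spherical graph: traverse the edge, then take the
next edge in counter-clockwise order at the vertex reached. -/
def faceStep (d : Γ.Dart) : Γ.Dart := Γ.rotate d.swap

/-- The faces of the spherical graph: the orbits of `faceStep`. -/
abbrev Face : Type := Quot fun d d' : Γ.Dart => Γ.faceStep d = d'

/-- The graph is embedded in the cylinder with the given cyclic orders at the internal vertices,
the sources in the given order on one boundary circle and the sinks in the given order on the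
other: the spherical graph satisfies Euler's formula `V - E + F = 2`. (For an acyclic network with
sources and sinks, the spherical graph is connected.) -/
def IsCylindrical : Prop :=
  Fintype.card Γ.White + Fintype.card Γ.Black + 2 + Nat.card Γ.Face = Fintype.card Γ.Edge + 2

variable {Γ} in
/-- The oriented intersection number with the cut of the step from `d` to `faceStep d`. The
first part of the step follows an edge. The second part crosses the cut only if it runs along a
boundary circle past an endpoint of the cut: downwards from the last to the first
sink, or upwards from the first to the last source. -/
def stepCrossing (cross : Γ.Edge → ℤ) : Γ.Dart → ℤ
  | .inl e => cross e + match Γ.finish e with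
    | .inl j => if (j : ℕ) + 1 = n then -1 else 0
    | .inr _ => 0
  | .inr e => -cross e + match Γ.start e with
    | .inl i => if (i : ℕ) = 0 then 1 else 0
    | .inr _ => 0

open Classical in
/-- `cross e` is the oriented intersection number of the edge `e` with a cut, i.e. a curve from
the left to the right boundary circle with its endpoints between the last and the first
source, and between the last and the first sink: edges crossing the cut upwards count `+1`. These
are the functions for which the total intersection number with the boundary of every face is `0`. -/
def IsCut (cross : Γ.Edge → ℤ) : Prop :=
  ∀ F : Γ.Face, ∑ d : Γ.Dart with Quot.mk _ d = F, stepCrossing cross d = 0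

end PerfectNetwork

/-- An acyclic perfect network on a cylinder, with all sources on one boundary circle and all sinks on
the other, and with a chosen cut. -/
structure CylindricalNetwork (m n : ℕ) extends PerfectNetwork m n where
  acyclic : toPerfectNetwork.IsAcyclic
  cylindrical : toPerfectNetwork.IsCylindrical
  /-- The oriented intersection number of an edge with the cut. -/
  cross : Edge → ℤ
  isCut : toPerfectNetwork.IsCut cross

namespace CylindricalNetwork

/-! ### The torus network and its double bracket -/

/-- Vertices of the torus network obtained by gluing the `i`-th sink to the `i`-th source. -/
inductive TorusVertex {N : ℕ} (Γ : CylindricalNetwork N N) : Type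
  | marked (i : Fin N)
  | white (w : Γ.White)
  | black (b : Γ.Black)

variable {N : ℕ} (Γ : CylindricalNetwork N N)

/-- The gluing map on vertices. -/
def glueVertex : Γ.Vertex → Γ.TorusVertex
  | .source i => .marked i
  | .white w => .white w
  | .black b => .black b
  | .sink j => .marked j

instance : Quiver Γ.TorusVertex :=
  ⟨fun u v => {e : Γ.Edge // Γ.glueVertex (Γ.src e) = u ∧ Γ.glueVertex (Γ.tgt e) = v}⟩

/-- The gluing map from the cylinder network to the torus network. -/
def glue : Γ.Vertex ⥤q Γ.TorusVertex where
  obj := Γ.glueVertex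
  map e := ⟨e.1, congrArg _ e.2.1, congrArg _ e.2.2⟩

open Classical in
/-- The coefficient at a white vertex: `1/2` if `e`, `f` are its first and second outgoing edges,
`-1/2` if they are the second and the first, and `0` otherwise. -/
def whiteCoeff (K : Type*) [Field K] (e f : Γ.Edge) : K :=
  match Γ.start e, Γ.start f with
  | .inr (.inl (w, false)), .inr (.inl (w', true)) => if w = w' then 1 / 2 else 0
  | .inr (.inl (w, true)), .inr (.inl (w', false)) => if w = w' then -(1 / 2) else 0
  | _, _ => 0

open Classical in
/-- The coefficient at a black vertex: `-1/2` if `e`, `f` are its first and second incoming edges,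
`1/2` if they are the second and the first, and `0` otherwise. -/
def blackCoeff (K : Type*) [Field K] (e f : Γ.Edge) : K :=
  match Γ.finish e, Γ.finish f with
  | .inr (.inr (b, false)), .inr (.inr (b', true)) => if b = b' then -(1 / 2) else 0
  | .inr (.inr (b, true)), .inr (.inr (b', false)) => if b = b' then 1 / 2 else 0
  | _, _ => 0

open Classical in
/-- The double brackets of edges, summed over the internal vertices:
`{{x₁, x₂}} = 1/2 x₁ ⊗ x₂` for the first and second outgoing edges of a white vertex,
`{{y₁, y₂}} = -1/2 y₂ ⊗ y₁` for the first and second incoming edges of a black vertex,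
the brackets with the opposite order of arguments by skew-symmetry, and no other contributions. -/
def edgeBracket (K : Type*) [Field K] : ArrowBracket K Γ.TorusVertex := fun a b c d e f =>
  (if h : a = c then
    Γ.whiteCoeff K e.1 f.1 •
      (ofPath K (Quiver.Hom.toPath (⟨e.1, e.2.1.trans h, e.2.2⟩ : c ⟶ b)) ⊗ₜ[K]
        ofPath K (Quiver.Hom.toPath (⟨f.1, f.2.1.trans h.symm, f.2.2⟩ : a ⟶ d)))
  else 0) +
  (if h : b = d then
    Γ.blackCoeff K e.1 f.1 •
      (ofPath K (Quiver.Hom.toPath (⟨f.1, f.2.1, f.2.2.trans h.symm⟩ : c ⟶ b)) ⊗ₜ[K]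
        ofPath K (Quiver.Hom.toPath (⟨e.1, e.2.1, e.2.2.trans h⟩ : a ⟶ d)))
  else 0)

/-! ### Boundary measurements -/

/-- The oriented intersection number of a path with the cut. -/
def crossing {u v : Γ.Vertex} (p : Quiver.Path u v) : ℤ :=
  Quiver.Path.addWeight
    (fun {u v : Γ.Vertex} (e : u ⟶ v) => Γ.cross (show {e // Γ.src e = u ∧ Γ.tgt e = v} from e).1) p

/-- Objects of the category `C` of paths of the torus network between the marked points. -/
abbrev marked : Fin N → Γ.TorusVertex := .marked

/-- There are finitely many paths between two vertices of an acyclic network. -/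
instance finite_path (u v : Γ.Vertex) : Finite (Quiver.Path u v) := by
  have hfin : Finite Γ.Vertex := by
    refine Finite.of_surjective
      (fun x : Fin N ⊕ Γ.White ⊕ Γ.Black ⊕ Fin N => (match x with
        | .inl i => .source i
        | .inr (.inl w) => .white w
        | .inr (.inr (.inl b)) => .black b
        | .inr (.inr (.inr j)) => .sink j : Γ.Vertex)) ?_
    rintro (i | w | b | j)
    exacts [⟨.inl i, rfl⟩, ⟨.inr (.inl w), rfl⟩, ⟨.inr (.inr (.inl b)), rfl⟩,
      ⟨.inr (.inr (.inr j)), rfl⟩]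
  let r : Γ.Vertex → Γ.Vertex → Prop := fun a b => ∃ p : Quiver.Path a b, p.length ≠ 0
  have htr : IsTrans Γ.Vertex r := ⟨fun a b c ⟨p, hp⟩ ⟨q, hq⟩ =>
    ⟨p.comp q, by rw [Quiver.Path.length_comp]; omega⟩⟩
  have hirr : Std.Irrefl r := ⟨fun a ⟨p, hp⟩ => hp (Γ.acyclic a p)⟩
  have hwf : WellFounded r := Finite.wellFounded_of_trans_of_irrefl r
  induction v using hwf.induction with
  | _ v ih =>
  have hsub : ∀ x : {e : Γ.Edge // Γ.tgt e = v}, Finite (Quiver.Path u (Γ.src x.1)) := fun x =>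
    ih _ ⟨(Quiver.Hom.toPath (⟨x.1, rfl, x.2⟩ : Γ.src x.1 ⟶ v)), by simp⟩
  refine Finite.of_surjective
    (fun x : PLift (u = v) ⊕ (Σ e : {e : Γ.Edge // Γ.tgt e = v}, Quiver.Path u (Γ.src e.1)) =>
      (match x with
        | .inl h => h.down ▸ .nil
        | .inr ⟨e, p⟩ => p.cons (⟨e.1, rfl, e.2⟩ : Γ.src e.1 ⟶ v) : Quiver.Path u v)) ?_
  intro p
  cases p with
  | nil => exact ⟨.inl ⟨rfl⟩, rfl⟩
  | cons p e =>
    obtain ⟨e, rfl, he⟩ := e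
    exact ⟨.inr ⟨⟨e, he⟩, p⟩, rfl⟩

/-- The boundary measurement matrix `B(z)`: its `(i,j)` entry is the sum, over the paths `p` from
the `i`-th source to the `j`-th sink, of `z ^ d` times the weight of `p`, where `d` is the oriented
intersection number of `p` with the cut. -/
def boundaryMeasurement {K : Type*} [Field K] (z : K) : PathMatrix K Γ.marked := fun i j =>
  ∑ᶠ p : Quiver.Path (PerfectNetwork.Vertex.source i : Γ.Vertex) (.sink j),
    z ^ Γ.crossing p • ofPath K (Γ.glue.mapPath p)

/-- The shifted matrix `X(z) = B(z) - 1`. -/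
def shiftedMeasurement {K : Type*} [Field K] (z : K) : PathMatrix K Γ.marked := fun i j =>
  Γ.boundaryMeasurement z i j - identityMatrix Γ.marked K i j

end CylindricalNetwork

/-! ## The trigonometric r-matrix and the ground field -/

/-- The coefficients `ρ_{ij}(λ, μ)` of the trigonometric r-matrix
`r(λ, μ) = ∑ ρ_{ij}(λ, μ) E_{ij} ⊠ E_{ji}`. -/
def rhoCoeff {K : Type*} [Field K] {N : ℕ} (lam mu : K) (i j : Fin N) : K :=
  if i < j then lam / (mu - lam)
  else if i = j then 1 / 2 * ((mu + lam) / (mu - lam))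
  else mu / (mu - lam)

/-- The field `ℂ(λ, μ)` of rational functions in two variables. -/
abbrev SpectralField : Type := FractionRing (MvPolynomial (Fin 2) ℂ)

/-- The spectral parameter `λ`. -/
def spectralLam : SpectralField := algebraMap (MvPolynomial (Fin 2) ℂ) SpectralField (.X 0)

/-- The spectral parameter `μ`. -/
def spectralMu : SpectralField := algebraMap (MvPolynomial (Fin 2) ℂ) SpectralField (.X 1)

/-! ## The Hamiltonian and the Lax matrix -/

namespace CylindricalNetwork

variable {N : ℕ} (Γ : CylindricalNetwork N N) {K : Type*} [Field K] (J : PathIdeal K Γ.marked)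

/-- The boundary measurement matrix regarded as a matrix over `Ĉ`. -/
def hatMeasurement (z : K) : J.HatMatrix := fun i j =>
  J.toCompletion i j (Γ.boundaryMeasurement z i j)

variable {lam : K} (hJ : ∀ i j : Fin N, Γ.shiftedMeasurement lam i j ∈ J.carrier i j)

/-- The matrix `log B(λ)` over `Ĉ`. -/
def logMeasurement : J.HatMatrix := J.logOneAdd (Γ.shiftedMeasurement lam) hJ

/-- The Hamiltonian `H(λ)`: the class of `1/2 tr ((log B(λ))²)` in the completed cyclic space. -/
def hamiltonian : J.cyclicCompletion :=
  (1 / 2 : K) • J.hatTrace (J.hatMul (Γ.logMeasurement J hJ) (Γ.logMeasurement J hJ))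

/-- The matrix with entries `ρ_{ji}(λ, μ) (log B(λ))_{ij}`. -/
def laxMatrix (mu : K) : J.HatMatrix := fun i j =>
  rhoCoeff lam mu j i • Γ.logMeasurement J hJ i j

end CylindricalNetwork

end

/-! The flow follows from a quadratic formula for two boundary measurements
(`doubleBracket_boundaryMeasurement`): with ρ = `rhoCoeff`, {{B(λ)_ij, B(μ)_kl}} = ρ_ik B(λ)_kj ⊗
B(μ)_il − ρ_lj B(μ)_kj ⊗ B(λ)_il.

Topological half. The Leibniz rules reduce the left side to pairs of edges meeting at a white or a
black vertex, where the two paths exchange tails. The resulting paths change their spectral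
parameter at that vertex. For fixed basis paths P and Q, their coefficients, as functions of the
edge where the parameter changes, are 1-cycles in rank-one local systems with monodromies μ/λ and
λ/μ (`twistedBoundary_flow`), and the sum over the vertices is an intersection pairing of these
cycles. As λ ≠ μ, every such cycle is the jump of a section over the faces (`exists_jump_eq`):
acyclicity and nontrivial monodromy make the jump map injective, and Euler's formula matches the
dimensions. Let T be one cycle times the average, across each edge, of the section bounding the
other. The divergence of T at an internal vertex is exactly the local pairing there, so only sources
and sinks survive the summation (`intersection_form`). On a boundary circle the section is constant
except for one jump and the monodromy; solving for its averages produces ρ (`boundary_average`).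

Algebraic half. Put X = B(λ) − 1. By Leibniz and cyclicity, bracketing tr q(X) with a morphism
amounts to inserting q'(X) into the double bracket of the entries of X
(`insertedBracket_matrixEval`). The quadratic formula then multiplies q'(X) by B(λ) = 1 + X, on the
left in one term and on the right in the other. For q = ½ log(1 + X)² either product is log B(λ),
whence the commutator. In the completion this is checked modulo each J^m with truncated logarithms,
for which the identity holds up to a multiple of X^m (`dvd_logPoly`).

Of the ground field, only characteristic zero and λ, μ being nonzero and distinct are used. -/

open scoped TensorProduct

noncomputable section

/-! ## Potentials on the orbits of a bijection -/

section Potential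

variable {D : Type*} (σ : D → D)

/-- The sum of `s` along the first `k` points of the orbit of `r`. -/
def orbitSum (s : D → ℤ) (r : D) (k : ℕ) : ℤ := ∑ j ∈ Finset.range k, s (σ^[j] r)

/-- On a finite set every point of an injective self-map is periodic, so backward steps in the
generated equivalence relation can be replaced by forward ones. -/
theorem exists_iterate_eq_of_mk_eq [Finite D] (hσ : Function.Injective σ) {a b : D}
    (h : Quot.mk (fun d d' : D => σ d = d') a = Quot.mk _ b) : ∃ k : ℕ, σ^[k] a = b := by
  have h' := Quot.eqvGen_exact h
  clear h
  induction h' with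
  | rel a b h => exact ⟨1, h⟩
  | refl a => exact ⟨0, rfl⟩
  | symm a b _ ih =>
    obtain ⟨k, rfl⟩ := ih
    obtain ⟨p, hp, hpa⟩ := Function.mem_periodicPts.1 (hσ.mem_periodicPts a)
    -- Completing the `k` steps already made to `p * k` steps, a multiple of the period, returns to
    -- `a`.
    refine ⟨p * k - k, ?_⟩
    rw [← Function.iterate_add_apply, Nat.sub_add_cancel (Nat.le_mul_of_pos_left k hp)]
    exact hpa.mul_const k
  | trans a b c _ _ ih₁ ih₂ =>
    obtain ⟨k, rfl⟩ := ih₁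
    obtain ⟨l, rfl⟩ := ih₂
    exact ⟨l + k, Function.iterate_add_apply σ l k a⟩

theorem mk_iterate (a : D) (k : ℕ) :
    Quot.mk (fun d d' : D => σ d = d') (σ^[k] a) = Quot.mk _ a := by
  induction k with
  | zero => rfl
  | succ k ih =>
    rw [Function.iterate_succ_apply', ← ih]
    exact (Quot.sound (r := fun d d' : D => σ d = d') rfl).symm

variable {σ}

open Classical in
-- The iterates below the minimal period list the class of `r` once each, so this is one of the sums
-- assumed to vanish.
theorem orbitSum_minimalPeriod [Fintype D] (hσ : Function.Injective σ) {s : D → ℤ}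
    (hs : ∀ F : Quot (fun d d' : D => σ d = d'), ∑ d : D with Quot.mk _ d = F, s d = 0) (r : D) :
    orbitSum σ s r (Function.minimalPeriod σ r) = 0 := by
  rw [← hs (Quot.mk _ r), orbitSum]
  refine Finset.sum_bij (fun j _ => σ^[j] r) ?_ ?_ ?_ (fun _ _ => rfl)
  · intro j _
    simpa using mk_iterate σ r j
  · intro j hj k hk h
    exact (Function.iterate_eq_iterate_iff_of_lt_minimalPeriod (Finset.mem_range.1 hj)
      (Finset.mem_range.1 hk)).1 h
  · intro b hb
    obtain ⟨k, rfl⟩ := exists_iterate_eq_of_mk_eq σ hσ (Finset.mem_filter.1 hb).2.symm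
    refine ⟨k % Function.minimalPeriod σ r, ?_, Function.iterate_mod_minimalPeriod_eq⟩
    exact Finset.mem_range.2 (Nat.mod_lt _
      (Function.minimalPeriod_pos_of_mem_periodicPts (hσ.mem_periodicPts r)))

open Classical in
-- Full turns contribute nothing, so the sum depends only on the point reached and not on the number
-- of steps taken.
theorem orbitSum_mod [Fintype D] (hσ : Function.Injective σ) {s : D → ℤ}
    (hs : ∀ F : Quot (fun d d' : D => σ d = d'), ∑ d : D with Quot.mk _ d = F, s d = 0) (r : D)
    (k : ℕ) : orbitSum σ s r (k % Function.minimalPeriod σ r) = orbitSum σ s r k := by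
  set p := Function.minimalPeriod σ r with hp
  have hstep : ∀ a, orbitSum σ s r (p + a) = orbitSum σ s r a := fun a => by
    have h0 := orbitSum_minimalPeriod hσ hs r
    unfold orbitSum at h0 ⊢
    rw [Finset.sum_range_add, h0, zero_add]
    refine Finset.sum_congr rfl fun j _ => ?_
    rw [add_comm, Function.iterate_add_apply, Function.iterate_minimalPeriod]
  have hmul : ∀ q a, orbitSum σ s r (p * q + a) = orbitSum σ s r a := by
    intro q a
    induction q with
    | zero => simp
    | succ q ih => rw [Nat.mul_succ, add_comm (p * q), add_assoc, hstep, ih]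
  conv_rhs => rw [← Nat.div_add_mod k p]
  exact (hmul _ _).symm

open Classical in
/-- A function whose sum over every orbit of a bijection vanishes is a coboundary. -/
theorem exists_potential [Fintype D] (hσ : Function.Injective σ) (s : D → ℤ)
    (hs : ∀ F : Quot (fun d d' : D => σ d = d'), ∑ d : D with Quot.mk _ d = F, s d = 0) :
    ∃ h : D → ℤ, ∀ d, h (σ d) = h d + s d := by
  have hrep : ∀ d : D, ∃ k : ℕ,
      σ^[k] (Quot.out (Quot.mk (fun d d' : D => σ d = d') d)) = d := fun d =>
    exists_iterate_eq_of_mk_eq σ hσ (Quot.out_eq _)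
  choose k hk using hrep
  -- Fix a representative in each orbit and integrate `s` from it to `d`.
  refine ⟨fun d => orbitSum σ s (Quot.out (Quot.mk (fun d d' : D => σ d = d') d)) (k d),
    fun d => ?_⟩
  have hq : Quot.mk (fun d d' : D => σ d = d') (σ d) = Quot.mk _ d :=
    (Quot.sound (r := fun d d' : D => σ d = d') rfl).symm
  have hkd := hk (σ d)
  beta_reduce
  rw [hq] at hkd ⊢
  have hkd' := hk d
  set r := Quot.out (Quot.mk (fun d d' : D => σ d = d') d)
  have hs1 : orbitSum σ s r (k d) + s d = orbitSum σ s r (k d + 1) := by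
    rw [orbitSum, orbitSum, Finset.sum_range_succ, hkd']
  -- `k (σ d)` and `k d + 1` both lead from `r` to `σ d`, hence agree modulo the period.
  rw [hs1, ← orbitSum_mod hσ hs r (k (σ d)), ← orbitSum_mod hσ hs r (k d + 1)]
  congr 1
  have hpos := Function.minimalPeriod_pos_of_mem_periodicPts (hσ.mem_periodicPts r)
  refine (Function.iterate_eq_iterate_iff_of_lt_minimalPeriod (f := σ) (x := r)
    (Nat.mod_lt _ hpos) (Nat.mod_lt _ hpos)).1 ?_
  rw [Function.iterate_mod_minimalPeriod_eq, Function.iterate_mod_minimalPeriod_eq, hkd,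
    Function.iterate_succ_apply', hkd']

end Potential

/-! ## Combinatorics of perfect networks -/

namespace PerfectNetwork

variable {m n : ℕ} (Γ : PerfectNetwork m n)

/-- The edge at the `i`-th source. -/
abbrev sourceEdge (i : Fin m) : Γ.Edge := Γ.start.symm (.inl i)

/-- The edge at the `j`-th sink. -/
abbrev sinkEdge (j : Fin n) : Γ.Edge := Γ.finish.symm (.inl j)

/-- The first (`c = false`) or second (`c = true`) outgoing edge of a white vertex. -/
abbrev whiteOut (w : Γ.White) (c : Bool) : Γ.Edge := Γ.start.symm (.inr (.inl (w, c)))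

/-- The incoming edge of a white vertex. -/
abbrev whiteIn (w : Γ.White) : Γ.Edge := Γ.finish.symm (.inr (.inl w))

/-- The outgoing edge of a black vertex. -/
abbrev blackOut (b : Γ.Black) : Γ.Edge := Γ.start.symm (.inr (.inr b))

/-- The first (`c = false`) or second (`c = true`) incoming edge of a black vertex. -/
abbrev blackIn (b : Γ.Black) (c : Bool) : Γ.Edge := Γ.finish.symm (.inr (.inr (b, c)))

@[simp] theorem src_sourceEdge (i : Fin m) : Γ.src (Γ.sourceEdge i) = .source i := by
  simp [src]

@[simp] theorem src_whiteOut (w : Γ.White) (c : Bool) : Γ.src (Γ.whiteOut w c) = .white w := by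
  simp [src]

@[simp] theorem src_blackOut (b : Γ.Black) : Γ.src (Γ.blackOut b) = .black b := by
  simp [src]

@[simp] theorem tgt_sinkEdge (j : Fin n) : Γ.tgt (Γ.sinkEdge j) = .sink j := by
  simp [tgt]

@[simp] theorem tgt_whiteIn (w : Γ.White) : Γ.tgt (Γ.whiteIn w) = .white w := by
  simp [tgt]

@[simp] theorem tgt_blackIn (b : Γ.Black) (c : Bool) : Γ.tgt (Γ.blackIn b c) = .black b := by
  simp [tgt]

/-- Each edge has exactly one initial half-edge. Compared with `sum_edge_finish`, this is a discrete
divergence theorem: the same sum is read from the starts and from the ends of the edges. -/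
theorem sum_edge_start {M : Type*} [AddCommMonoid M] (F : Γ.Edge → M) :
    ∑ e, F e = ∑ i, F (Γ.sourceEdge i) +
      (∑ w, (F (Γ.whiteOut w false) + F (Γ.whiteOut w true)) + ∑ b, F (Γ.blackOut b)) := by
  rw [← Equiv.sum_comp Γ.start.symm F, Fintype.sum_sum_type, Fintype.sum_sum_type,
    Fintype.sum_prod_type]
  simp only [Fintype.sum_bool, add_comm (F (Γ.start.symm (.inr (.inl (_, true)))))]

theorem sum_edge_finish {M : Type*} [AddCommMonoid M] (F : Γ.Edge → M) :
    ∑ e, F e = ∑ j, F (Γ.sinkEdge j) +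
      (∑ w, F (Γ.whiteIn w) + ∑ b, (F (Γ.blackIn b false) + F (Γ.blackIn b true))) := by
  rw [← Equiv.sum_comp Γ.finish.symm F, Fintype.sum_sum_type, Fintype.sum_sum_type,
    Fintype.sum_prod_type]
  simp only [Fintype.sum_bool, add_comm (F (Γ.finish.symm (.inr (.inr (_, true)))))]

theorem edge_start_cases (e : Γ.Edge) : (∃ i, e = Γ.sourceEdge i) ∨
    (∃ w c, e = Γ.whiteOut w c) ∨ ∃ b, e = Γ.blackOut b := by
  obtain ⟨x, rfl⟩ := Γ.start.symm.surjective e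
  rcases x with i | ⟨w, c⟩ | b
  exacts [.inl ⟨i, rfl⟩, .inr (.inl ⟨w, c, rfl⟩), .inr (.inr ⟨b, rfl⟩)]

theorem edge_finish_cases (e : Γ.Edge) : (∃ j, e = Γ.sinkEdge j) ∨
    (∃ w, e = Γ.whiteIn w) ∨ ∃ b c, e = Γ.blackIn b c := by
  obtain ⟨x, rfl⟩ := Γ.finish.symm.surjective e
  rcases x with j | w | ⟨b, c⟩
  exacts [.inl ⟨j, rfl⟩, .inr (.inl ⟨w, rfl⟩), .inr (.inr ⟨b, c, rfl⟩)]

/-- The inverse of `rotate`. -/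
def rotateInv : Γ.Dart → Γ.Dart
  | .inl e => match Γ.start e with
    | .inl i => .inl (Γ.sourceEdge (finRotate m i))
    | .inr (.inl (w, false)) => .inr (Γ.whiteIn w)
    | .inr (.inl (w, true)) => .inl (Γ.whiteOut w false)
    | .inr (.inr b) => .inr (Γ.blackIn b true)
  | .inr e => match Γ.finish e with
    | .inl j => .inr (Γ.sinkEdge ((finRotate n).symm j))
    | .inr (.inl w) => .inl (Γ.whiteOut w true)
    | .inr (.inr (b, false)) => .inl (Γ.blackOut b)
    | .inr (.inr (b, true)) => .inr (Γ.blackIn b false)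

theorem rotate_injective : Function.Injective Γ.rotate := by
  refine Function.LeftInverse.injective (g := Γ.rotateInv) ?_
  rintro (e | e)
  · rcases Γ.edge_start_cases e with ⟨i, rfl⟩ | ⟨w, _ | _, rfl⟩ | ⟨b, rfl⟩ <;>
      simp only [rotate, rotateInv, Equiv.apply_symm_apply]
  · rcases Γ.edge_finish_cases e with ⟨i, rfl⟩ | ⟨w, rfl⟩ | ⟨b, _ | _, rfl⟩ <;>
      simp only [rotate, rotateInv, Equiv.apply_symm_apply, Equiv.symm_apply_apply]

theorem faceStep_injective : Function.Injective Γ.faceStep :=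
  Γ.rotate_injective.comp Sum.swap_leftInverse.injective

instance : Finite Γ.Vertex := by
  refine Finite.of_surjective
    (fun x : Fin m ⊕ Γ.White ⊕ Γ.Black ⊕ Fin n => (match x with
      | .inl i => .source i
      | .inr (.inl w) => .white w
      | .inr (.inr (.inl b)) => .black b
      | .inr (.inr (.inr j)) => .sink j : Γ.Vertex)) ?_
  rintro (i | w | b | j)
  exacts [⟨.inl i, rfl⟩, ⟨.inr (.inl w), rfl⟩, ⟨.inr (.inr (.inl b)), rfl⟩,
    ⟨.inr (.inr (.inr j)), rfl⟩]

variable {Γ}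

/-- Being joined by a nontrivial path is transitive, is irreflexive by acyclicity, and lives on a
finite set. -/
theorem IsAcyclic.wellFounded (h : Γ.IsAcyclic) :
    WellFounded fun u v : Γ.Vertex => ∃ e, Γ.src e = u ∧ Γ.tgt e = v := by
  let r : Γ.Vertex → Γ.Vertex → Prop := fun a b => ∃ p : Quiver.Path a b, p.length ≠ 0
  have htr : IsTrans Γ.Vertex r := ⟨fun a b c ⟨p, hp⟩ ⟨q, hq⟩ =>
    ⟨p.comp q, by rw [Quiver.Path.length_comp]; omega⟩⟩
  have hirr : Std.Irrefl r := ⟨fun a ⟨p, hp⟩ => hp (h a p)⟩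
  have hwf : WellFounded r := Finite.wellFounded_of_trans_of_irrefl r
  refine Subrelation.wf (fun {u v} ⟨e, he⟩ => ?_) hwf
  exact ⟨Quiver.Hom.toPath (⟨e, he⟩ : u ⟶ v), by simp⟩

/-- Induction along an acyclic network: a property of edges that holds at the sources and
propagates through internal vertices holds everywhere. -/
theorem IsAcyclic.edge_induction (h : Γ.IsAcyclic) {P : Γ.Edge → Prop}
    (hsource : ∀ i, P (Γ.sourceEdge i))
    (hwhite : ∀ w c, P (Γ.whiteIn w) → P (Γ.whiteOut w c))
    (hblack : ∀ b, P (Γ.blackIn b false) → P (Γ.blackIn b true) → P (Γ.blackOut b))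
    (e : Γ.Edge) : P e := by
  suffices H : ∀ v e, Γ.src e = v → P e from H _ e rfl
  intro v
  induction v using h.wellFounded.induction with
  | _ v ih =>
  intro e he
  have key : ∀ f, Γ.tgt f = Γ.src e → P f := fun f hf => ih _ ⟨f, rfl, hf.trans he⟩ f rfl
  rcases Γ.edge_start_cases e with ⟨i, rfl⟩ | ⟨w, c, rfl⟩ | ⟨b, rfl⟩
  · exact hsource i
  · exact hwhite w c (key _ (by simp))
  · exact hblack b (key _ (by simp)) (key _ (by simp))

end PerfectNetwork

namespace PerfectNetwork

/-! ## Twisted homology of the cylinder -/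

section TwistedHomology

variable {m n : ℕ} (Γ : PerfectNetwork m n) {K : Type*} [Field K] (cross : Γ.Edge → ℤ) (t : K)

/-- The boundary, at the internal vertices, of a chain with coefficients in the local system
with monodromy `t`. -/
def twistedBoundary : (Γ.Edge → K) →ₗ[K] (Γ.White ⊕ Γ.Black → K) where
  toFun U := Sum.elim
    -- `U e` is expressed in the trivialization at the foot of `e`; the factor `t ^ cross e` carries
    -- it to the head.
    (fun w => t ^ cross (Γ.whiteIn w) * U (Γ.whiteIn w) -
      (U (Γ.whiteOut w false) + U (Γ.whiteOut w true)))
    (fun b => t ^ cross (Γ.blackIn b false) * U (Γ.blackIn b false) +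
      t ^ cross (Γ.blackIn b true) * U (Γ.blackIn b true) - U (Γ.blackOut b))
  map_add' U U' := by
    ext (w | b) <;> simp only [Pi.add_apply, Sum.elim_inl, Sum.elim_inr] <;> ring
  map_smul' r U := by
    ext (w | b) <;>
      simp only [Pi.smul_apply, smul_eq_mul, Sum.elim_inl, Sum.elim_inr, RingHom.id_apply] <;> ring

theorem twistedBoundary_inl (U : Γ.Edge → K) (w : Γ.White) :
    Γ.twistedBoundary cross t U (.inl w) = t ^ cross (Γ.whiteIn w) * U (Γ.whiteIn w) -
      (U (Γ.whiteOut w false) + U (Γ.whiteOut w true)) := rfl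

theorem twistedBoundary_inr (U : Γ.Edge → K) (b : Γ.Black) :
    Γ.twistedBoundary cross t U (.inr b) =
      t ^ cross (Γ.blackIn b false) * U (Γ.blackIn b false) +
      t ^ cross (Γ.blackIn b true) * U (Γ.blackIn b true) - U (Γ.blackOut b) := rfl

/-- A section over the faces of the local system with monodromy `t`: its value at a dart is the
value on the face to the right of the dart, in the trivialization at the foot of the dart. -/
def IsFaceSection (φ : Γ.Dart → K) : Prop :=
  ∀ d, φ (Γ.faceStep d) = t ^ stepCrossing cross d * φ d

/-- The jump across the edges of a section over the faces. -/
def jump : (Γ.Dart → K) →ₗ[K] (Γ.Edge → K) where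
  -- The face to the right of the reversed dart `.inr e` lies to the left of `e`, so this is left
  -- minus right, both taken at the foot of `e`.
  toFun φ e := t ^ (-cross e) * φ (.inr e) - φ (.inl e)
  map_add' φ φ' := by ext e; simp only [Pi.add_apply]; ring
  map_smul' r φ := by
    ext e; simp only [Pi.smul_apply, smul_eq_mul, RingHom.id_apply]; ring

theorem jump_apply (φ : Γ.Dart → K) (e : Γ.Edge) :
    Γ.jump cross t φ e = t ^ (-cross e) * φ (.inr e) - φ (.inl e) := rfl

variable {Γ cross t}

/-! ### Relations for a face section, one for each corner at a vertex. -/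

namespace IsFaceSection

variable {φ : Γ.Dart → K} (h : Γ.IsFaceSection cross t φ)
include h

theorem whiteIn_right (w : Γ.White) :
    φ (.inl (Γ.whiteOut w false)) = t ^ cross (Γ.whiteIn w) * φ (.inl (Γ.whiteIn w)) := by
  simpa [faceStep, rotate, stepCrossing] using h (.inl (Γ.whiteIn w))

theorem whiteOut_middle (w : Γ.White) :
    φ (.inl (Γ.whiteOut w true)) =
      t ^ (-cross (Γ.whiteOut w false)) * φ (.inr (Γ.whiteOut w false)) := by
  simpa [faceStep, rotate, stepCrossing] using h (.inr (Γ.whiteOut w false))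

theorem whiteIn_left (w : Γ.White) :
    φ (.inr (Γ.whiteIn w)) =
      t ^ (-cross (Γ.whiteOut w true)) * φ (.inr (Γ.whiteOut w true)) := by
  simpa [faceStep, rotate, stepCrossing] using h (.inr (Γ.whiteOut w true))

theorem blackIn_middle (b : Γ.Black) :
    φ (.inr (Γ.blackIn b true)) =
      t ^ cross (Γ.blackIn b false) * φ (.inl (Γ.blackIn b false)) := by
  simpa [faceStep, rotate, stepCrossing] using h (.inl (Γ.blackIn b false))

theorem blackOut_right (b : Γ.Black) :
    φ (.inl (Γ.blackOut b)) =
      t ^ cross (Γ.blackIn b true) * φ (.inl (Γ.blackIn b true)) := by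
  simpa [faceStep, rotate, stepCrossing] using h (.inl (Γ.blackIn b true))

theorem blackOut_left (b : Γ.Black) :
    φ (.inr (Γ.blackIn b false)) = t ^ (-cross (Γ.blackOut b)) * φ (.inr (Γ.blackOut b)) := by
  simpa [faceStep, rotate, stepCrossing] using h (.inr (Γ.blackOut b))

theorem source (i : Fin m) :
    φ (.inl (Γ.sourceEdge ((finRotate m).symm i))) =
      t ^ (-cross (Γ.sourceEdge i) + if (i : ℕ) = 0 then 1 else 0) *
        φ (.inr (Γ.sourceEdge i)) := by
  have := h (.inr (Γ.sourceEdge i))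
  simpa only [faceStep, rotate, stepCrossing, Sum.swap_inr, Equiv.apply_symm_apply] using this

theorem sink (j : Fin n) :
    φ (.inr (Γ.sinkEdge (finRotate n j))) =
      t ^ (cross (Γ.sinkEdge j) + if (j : ℕ) + 1 = n then -1 else 0) *
        φ (.inl (Γ.sinkEdge j)) := by
  have := h (.inl (Γ.sinkEdge j))
  simpa only [faceStep, rotate, stepCrossing, Sum.swap_inl, Equiv.apply_symm_apply] using this

/-- Jumps of sections over the faces are cycles. -/
theorem twistedBoundary_jump (ht : t ≠ 0) :
    Γ.twistedBoundary cross t (Γ.jump cross t φ) = 0 := by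
  have hz : ∀ k : ℤ, t ^ k * t ^ (-k) = 1 := fun k => by
    rw [← zpow_add₀ ht, add_neg_cancel, zpow_zero]
  ext (w | b)
  · rw [twistedBoundary_inl, jump_apply, jump_apply, jump_apply, mul_sub, ← h.whiteIn_right,
      ← mul_assoc, hz, one_mul, h.whiteIn_left, ← h.whiteOut_middle]
    simp
  · rw [twistedBoundary_inr, jump_apply, jump_apply, jump_apply, mul_sub, mul_sub,
      ← h.blackIn_middle, ← h.blackOut_right, ← mul_assoc, ← mul_assoc, hz, hz, one_mul, one_mul,
      h.blackOut_left]
    simp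

end IsFaceSection

/-- A sequence around a boundary circle: `L k` and `R k` are the values above and below the `k`-th
marked point, with monodromy `t`. -/
theorem boundary_values {N : ℕ} {K : Type*} [Field K] {t : K} {L R : Fin N → K}
    (hLR : ∀ k : Fin N, R k = t ^ (if (k : ℕ) + 1 = N then (1 : ℤ) else 0) * L (finRotate N k))
    {i : Fin N} {c : K} (hc : ∀ k, L k - R k = if k = i then c else 0) (k : Fin N) :
    (1 - t) * L k = (if i < k then t else 1) * c := by
  have hN : 0 < N := i.pos
  have hstep : ∀ k : Fin N, ∀ hk : (k : ℕ) + 1 < N, L ⟨k + 1, hk⟩ = R k := fun k hk => by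
    rw [hLR k, if_neg hk.ne, zpow_zero, one_mul]
    congr 1
    obtain ⟨N, rfl⟩ : ∃ N', N = N' + 1 := ⟨N - 1, by omega⟩
    refine Fin.ext ?_
    rw [coe_finRotate_of_ne_last]
    intro h
    rw [h] at hk
    simp at hk
  -- Going down the circle, the value changes only on passing `i`, where it drops by `c`.
  have hL : ∀ (k : ℕ) (hk : k < N), L ⟨k, hk⟩ = L ⟨0, hN⟩ - if (i : ℕ) < k then c else 0 := by
    intro k
    induction k with
    | zero => simp
    | succ k ih =>
      intro hk
      have h1 := ih (by omega)
      have h2 := hc ⟨k, by omega⟩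
      have h3 := hstep ⟨k, by omega⟩ hk
      simp only [Fin.ext_iff] at h1 h2 h3
      rw [h3]
      rcases lt_trichotomy (i : ℕ) k with hik | hik | hik
      · rw [if_neg (by omega)] at h2
        rw [if_pos hik] at h1
        rw [if_pos (by omega)]
        linear_combination h1 - h2
      · rw [if_pos hik.symm] at h2
        rw [if_neg (by omega)] at h1
        rw [if_pos (by omega)]
        linear_combination h1 - h2
      · rw [if_neg (by omega)] at h2
        rw [if_neg (by omega)] at h1
        rw [if_neg (by omega)]
        linear_combination h1 - h2
  -- After a full turn the total drop `c` must be compensated by the monodromy, which determines `L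
  -- 0` up to the factor `1 - t`.
  have hwrap : L ⟨0, hN⟩ - c = t * L ⟨0, hN⟩ := by
    have hl : ((⟨N - 1, by omega⟩ : Fin N) : ℕ) + 1 = N := by simp; omega
    have h1 := hLR ⟨N - 1, by omega⟩
    rw [if_pos hl, zpow_one] at h1
    have h0 : finRotate N ⟨N - 1, by omega⟩ = ⟨0, hN⟩ := by
      obtain ⟨N, rfl⟩ : ∃ N', N = N' + 1 := ⟨N - 1, by omega⟩
      exact finRotate_last
    rw [h0] at h1
    have h2 := hc ⟨N - 1, by omega⟩
    have h3 := hL (N - 1) (by omega)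
    have hi := i.isLt
    rcases Nat.lt_or_ge (i : ℕ) (N - 1) with hiN | hiN
    · rw [if_neg (fun h => by simp [← h] at hiN)] at h2
      rw [if_pos hiN] at h3
      linear_combination h2 - h3 + h1
    · rw [if_pos (Fin.ext (by simp; omega))] at h2
      rw [if_neg (by omega)] at h3
      linear_combination h2 - h3 + h1
  rw [show L k = _ from hL k k.isLt]
  by_cases hik : i < k
  · rw [if_pos hik, if_pos (Fin.lt_def.1 hik)]
    linear_combination hwrap
  · rw [if_neg hik, if_neg (fun h => hik (Fin.lt_def.2 h))]
    linear_combination hwrap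

/-- A section over the faces without jumps vanishes if the monodromy is not trivial. -/
theorem IsFaceSection.eq_zero (hΓ : Γ.IsAcyclic) (ht : t ≠ 0) (ht1 : t ≠ 1) {φ : Γ.Dart → K}
    (h : Γ.IsFaceSection cross t φ) (hj : Γ.jump cross t φ = 0) : φ = 0 := by
  have hLR : ∀ e, t ^ (-cross e) * φ (.inr e) = φ (.inl e) := fun e =>
    sub_eq_zero.1 (congrFun hj e)
  have hR : ∀ e, φ (.inl e) = 0 := by
    refine hΓ.edge_induction (fun i => ?_) (fun w c hw => ?_) (fun b _ hb => ?_)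
    -- Without jumps, the two sides of each source edge carry the same value; the case `c = 0` then
    -- gives `(1 - t) * φ = 0` on the source circle. The other edges inherit zero through the corner
    -- relations.
    · have := boundary_values (t := t) (L := fun k => φ (.inl (Γ.sourceEdge k)))
        (R := fun k => φ (.inl (Γ.sourceEdge k))) (i := i) (c := 0) (fun k => ?_) (by simp) i
      · simpa [sub_ne_zero.2 ht1.symm] using this
      · have hs := h.source (finRotate m k)
        rw [Equiv.symm_apply_apply, zpow_add₀ ht, mul_right_comm, hLR, mul_comm] at hs
        rw [hs]
        congr 2
        obtain ⟨m, rfl⟩ : ∃ m', m = m' + 1 := ⟨m - 1, by have := i.pos; omega⟩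
        by_cases hk : k = Fin.last m
        · simp [hk]
        · have hk' : (k : ℕ) ≠ m := fun h => hk (Fin.ext h)
          rw [coe_finRotate_of_ne_last hk]
          simp [hk']
    · have h0 : φ (.inl (Γ.whiteOut w false)) = 0 := by rw [h.whiteIn_right, hw, mul_zero]
      cases c
      · exact h0
      · rw [h.whiteOut_middle, hLR, h0]
    · rw [h.blackOut_right, hb, mul_zero]
  ext (e | e)
  · exact hR e
  · have := hLR e
    rw [hR e] at this
    simpa [ht, zpow_ne_zero] using this

/-- The boundary of a single edge is a unit multiple of its head minus its tail. Every internal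
vertex has an incoming edge, so induction from the sources puts each basis vector in the range. This
fixes the dimension of the space of cycles as edges minus internal vertices. -/
theorem twistedBoundary_surjective (hΓ : Γ.IsAcyclic) (ht : t ≠ 0) :
    Function.Surjective (Γ.twistedBoundary cross t) := by
  classical
  rw [← LinearMap.range_eq_top]
  set S := LinearMap.range (Γ.twistedBoundary cross t)
  -- Sources and sinks get the value 0, since the boundary is recorded only at internal vertices;
  -- the zero at the sources starts the induction.
  let δ : Γ.Vertex → (Γ.White ⊕ Γ.Black → K) := fun v => match v with
    | .white w => Pi.single (.inl w) 1
    | .black b => Pi.single (.inr b) 1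
    | _ => 0
  have hb : ∀ e, Γ.twistedBoundary cross t (Pi.single e 1) =
      t ^ cross e • δ (Γ.tgt e) - δ (Γ.src e) := by
    have h1 : ∀ e w, δ (Γ.tgt e) (.inl w) = (Pi.single e 1 : Γ.Edge → K) (Γ.whiteIn w) := by
      intro e w
      rcases Γ.edge_finish_cases e with ⟨j, rfl⟩ | ⟨w', rfl⟩ | ⟨b', c, rfl⟩ <;>
        simp [δ, Pi.single_apply]
    have h2 : ∀ e b, δ (Γ.tgt e) (.inr b) = (Pi.single e 1 : Γ.Edge → K) (Γ.blackIn b false) +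
        (Pi.single e 1 : Γ.Edge → K) (Γ.blackIn b true) := by
      intro e b
      rcases Γ.edge_finish_cases e with ⟨j, rfl⟩ | ⟨w', rfl⟩ | ⟨b', _ | _, rfl⟩ <;>
        simp [δ, Pi.single_apply]
    have h3 : ∀ e w, δ (Γ.src e) (.inl w) = (Pi.single e 1 : Γ.Edge → K) (Γ.whiteOut w false) +
        (Pi.single e 1 : Γ.Edge → K) (Γ.whiteOut w true) := by
      intro e w
      rcases Γ.edge_start_cases e with ⟨j, rfl⟩ | ⟨w', _ | _, rfl⟩ | ⟨b', rfl⟩ <;>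
        simp [δ, Pi.single_apply]
    have h4 : ∀ e b, δ (Γ.src e) (.inr b) = (Pi.single e 1 : Γ.Edge → K) (Γ.blackOut b) := by
      intro e b
      rcases Γ.edge_start_cases e with ⟨j, rfl⟩ | ⟨w', c, rfl⟩ | ⟨b', rfl⟩ <;>
        simp [δ, Pi.single_apply]
    have hc : ∀ e f, t ^ cross f * (Pi.single e 1 : Γ.Edge → K) f =
        t ^ cross e * (Pi.single e 1 : Γ.Edge → K) f := by
      intro e f
      by_cases hef : f = e
      · rw [hef]
      · rw [Pi.single_eq_of_ne hef, mul_zero, mul_zero]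
    intro e
    ext (w | b)
    · rw [twistedBoundary_inl, Pi.sub_apply, Pi.smul_apply, smul_eq_mul, h1, h3, hc]
    · rw [twistedBoundary_inr, Pi.sub_apply, Pi.smul_apply, smul_eq_mul, h2, h4, hc, hc, mul_add]
  have hstep : ∀ e, δ (Γ.src e) ∈ S → δ (Γ.tgt e) ∈ S := fun e he => by
    have h1 : t ^ cross e • δ (Γ.tgt e) ∈ S := by
      have h2 : Γ.twistedBoundary cross t (Pi.single e 1) ∈ S := ⟨_, rfl⟩
      rw [hb] at h2
      simpa using add_mem h2 he
    have h2 := S.smul_mem (t ^ (-cross e)) h1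
    rwa [smul_smul, ← zpow_add₀ ht, neg_add_cancel, zpow_zero, one_smul] at h2
  have hS : ∀ v, δ v ∈ S := by
    intro v
    induction v using hΓ.wellFounded.induction with
    | _ v ih =>
    rcases v with i | w | b | j
    · exact S.zero_mem
    · have := hstep (Γ.whiteIn w) (ih _ ⟨Γ.whiteIn w, rfl, by simp⟩)
      rwa [tgt_whiteIn] at this
    · have := hstep (Γ.blackIn b true) (ih _ ⟨Γ.blackIn b true, rfl, by simp⟩)
      rwa [tgt_blackIn] at this
    · exact S.zero_mem
  rw [eq_top_iff, ← (Pi.basisFun K (Γ.White ⊕ Γ.Black)).span_eq, Submodule.span_le]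
  rintro _ ⟨w | b, rfl⟩
  · rw [Pi.basisFun_apply]
    exact hS (.white w)
  · rw [Pi.basisFun_apply]
    exact hS (.black b)

/-- The first twisted homology of the cylinder vanishes: every cycle is the jump of a section over
the faces. -/
theorem exists_jump_eq (hΓ : Γ.IsAcyclic) (hcyl : Γ.IsCylindrical) (hcut : Γ.IsCut cross)
    (ht : t ≠ 0) (ht1 : t ≠ 1) {U : Γ.Edge → K} (hU : Γ.twistedBoundary cross t U = 0) :
    ∃ φ, Γ.IsFaceSection cross t φ ∧ Γ.jump cross t φ = U := by
  classical
  obtain ⟨p, hp⟩ := exists_potential Γ.faceStep_injective (stepCrossing cross) hcut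
  have := Fintype.ofFinite Γ.Face
  -- A potential `p` for the crossings trivializes the local system along each face, giving one free
  -- scalar per face.
  let s : (Γ.Face → K) →ₗ[K] (Γ.Dart → K) :=
    { toFun := fun ψ d => t ^ p d * ψ (Quot.mk _ d)
      map_add' := fun ψ ψ' => by ext d; simp only [Pi.add_apply]; ring
      map_smul' := fun r ψ => by
        ext d; simp only [Pi.smul_apply, smul_eq_mul, RingHom.id_apply]; ring }
  have hs : ∀ ψ, Γ.IsFaceSection cross t (s ψ) := fun ψ d => by
    change t ^ p (Γ.faceStep d) * ψ (Quot.mk _ (Γ.faceStep d)) = _ * (t ^ p d * ψ (Quot.mk _ d))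
    rw [hp, zpow_add₀ ht,
      ← Quot.sound (r := fun d d' : Γ.Dart => Γ.faceStep d = d') (a := d) rfl]
    ring
  have hinj : Function.Injective (Γ.jump cross t ∘ₗ s) := by
    rw [← LinearMap.ker_eq_bot, LinearMap.ker_eq_bot']
    intro ψ hψ
    have h0 := (hs ψ).eq_zero hΓ ht ht1 hψ
    ext F
    obtain ⟨d, rfl⟩ := Quot.exists_rep F
    have := congrFun h0 d
    simpa [s, ht, zpow_ne_zero] using this
  have hle : LinearMap.range (Γ.jump cross t ∘ₗ s) ≤ LinearMap.ker (Γ.twistedBoundary cross t) := by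
    rintro _ ⟨ψ, rfl⟩
    exact (hs ψ).twistedBoundary_jump ht
  have heq : LinearMap.range (Γ.jump cross t ∘ₗ s) = LinearMap.ker (Γ.twistedBoundary cross t) := by
    -- The range has dimension equal to the number of faces, the kernel to edges minus internal
    -- vertices; Euler's formula says these agree.
    refine Submodule.eq_of_le_of_finrank_eq hle ?_
    have h1 := LinearMap.finrank_range_of_inj hinj
    have h2 := LinearMap.finrank_range_add_finrank_ker (Γ.twistedBoundary cross t)
    rw [LinearMap.range_eq_top.2 (twistedBoundary_surjective hΓ ht), finrank_top] at h2
    rw [Module.finrank_fintype_fun_eq_card] at h1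
    rw [Module.finrank_fintype_fun_eq_card, Module.finrank_fintype_fun_eq_card,
      Fintype.card_sum] at h2
    have h3 : _ + _ = _ := hcyl
    rw [Nat.card_eq_fintype_card] at h3
    omega
  obtain ⟨ψ, hψ⟩ : U ∈ LinearMap.range (Γ.jump cross t ∘ₗ s) := heq ▸ hU
  exact ⟨s ψ, hs ψ, hψ⟩

end TwistedHomology

end PerfectNetwork

namespace CylindricalNetwork

/-! ## The intersection form of two cycles -/

section IntersectionForm

variable {N : ℕ} (Γ : CylindricalNetwork N N) {K : Type*} [Field K]

theorem sum_whiteCoeff (F : Γ.Edge → Γ.Edge → K) :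
    ∑ e, ∑ f, Γ.whiteCoeff K e f * F e f =
      ∑ w, (1 / 2 * F (Γ.whiteOut w false) (Γ.whiteOut w true) -
        1 / 2 * F (Γ.whiteOut w true) (Γ.whiteOut w false)) := by
  have hite : ∀ (g : Γ.White → K) w, ∑ w', (@ite _ (w = w') (Classical.propDecidable _) (g w') 0) =
      g w := fun g w => by
    classical
    simp
  simp only [Γ.sum_edge_start, whiteCoeff, Equiv.apply_symm_apply, zero_mul,
    Finset.sum_const_zero, zero_add, add_zero, ite_mul, hite, neg_mul, sub_eq_add_neg,
    Finset.sum_add_distrib]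

theorem sum_blackCoeff (F : Γ.Edge → Γ.Edge → K) :
    ∑ e, ∑ f, Γ.blackCoeff K e f * F e f =
      ∑ b, (1 / 2 * F (Γ.blackIn b true) (Γ.blackIn b false) -
        1 / 2 * F (Γ.blackIn b false) (Γ.blackIn b true)) := by
  have hite : ∀ (g : Γ.Black → K) b, ∑ b', (@ite _ (b = b') (Classical.propDecidable _) (g b') 0) =
      g b := fun g b => by
    classical
    simp
  simp only [Γ.sum_edge_finish, blackCoeff, Equiv.apply_symm_apply, zero_mul,
    Finset.sum_const_zero, zero_add, add_zero, ite_mul, hite, neg_mul, sub_eq_add_neg,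
    Finset.sum_add_distrib]
  rw [add_comm]

variable [CharZero K] {lam mu : K}

/-- This is where ρ originates. With monodromy λ/μ, the value above the marked point is μ/(μ−λ)·c up
to and including `i`, and λ/(μ−λ)·c beyond. The value below differs only at `i`, where the average
is the midpoint of the two. -/
theorem boundary_average (hmu : mu ≠ 0) (hne : lam ≠ mu) {L R : Fin N → K}
    (hLR : ∀ k : Fin N,
      R k = (lam / mu) ^ (if (k : ℕ) + 1 = N then (1 : ℤ) else 0) * L (finRotate N k))
    {i : Fin N} {c : K} (hc : ∀ k, L k - R k = if k = i then c else 0) (k : Fin N) :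
    1 / 2 * (L k + R k) = rhoCoeff lam mu i k * c := by
  have h1 := PerfectNetwork.boundary_values hLR hc k
  have h2 : R k = L k - if k = i then c else 0 := by rw [← hc k]; ring
  have h3 : mu - lam ≠ 0 := sub_ne_zero.2 hne.symm
  have h4 : 1 - lam / mu ≠ 0 := by
    rw [one_sub_div hmu]; exact div_ne_zero h3 hmu
  have h5 : L k = (if i < k then lam else mu) / (mu - lam) * c := by
    refine mul_left_cancel₀ h4 (h1.trans ?_)
    split_ifs <;> field_simp
  rw [h2, h5, rhoCoeff]
  rcases lt_trichotomy i k with h | h | h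
  · rw [if_pos h, if_neg h.ne', if_pos h]
    ring
  · subst h
    simp only [lt_irrefl, if_false, if_true]
    field_simp
    ring
  · rw [if_neg h.asymm, if_neg h.ne, if_neg h.asymm, if_neg h.ne']
    ring

/-- Stokes' theorem: writing `U` as the jump of a section φ turns the pairing at each internal
vertex into the net inflow of `W` times the average of φ across an edge. After summation only the
boundary fluxes at the sources and the sinks remain. -/
theorem intersection_form (hlam : lam ≠ 0) (hmu : mu ≠ 0) (hne : lam ≠ mu) {W U : Γ.Edge → K}
    (hW : Γ.twistedBoundary Γ.cross (mu / lam) W = 0)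
    (hU : Γ.twistedBoundary Γ.cross (lam / mu) U = 0)
    {i j k l : Fin N} {A A' C C' : K}
    (hWs : ∀ k', W (Γ.sourceEdge k') = if k' = k then A else 0)
    (hWt : ∀ j', (mu / lam) ^ Γ.cross (Γ.sinkEdge j') * W (Γ.sinkEdge j') =
      if j' = j then A' else 0)
    (hUs : ∀ i', U (Γ.sourceEdge i') = if i' = i then C else 0)
    (hUt : ∀ l', (lam / mu) ^ Γ.cross (Γ.sinkEdge l') * U (Γ.sinkEdge l') =
      if l' = l then C' else 0) :
    ∑ e, ∑ f, Γ.whiteCoeff K e f * (W e * U f) +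
      ∑ e, ∑ f, Γ.blackCoeff K e f *
        ((mu / lam) ^ Γ.cross f * W f * ((lam / mu) ^ Γ.cross e * U e)) =
      rhoCoeff lam mu i k * (A * C) - rhoCoeff lam mu l j * (A' * C') := by
  have ht : lam / mu ≠ 0 := div_ne_zero hlam hmu
  have ht1 : lam / mu ≠ 1 := fun h => hne ((div_eq_one_iff_eq hmu).1 h)
  obtain ⟨φ, hφ, rfl⟩ := PerfectNetwork.exists_jump_eq Γ.acyclic Γ.cylindrical Γ.isCut ht ht1 hU
  set t := lam / mu with htdef
  have hinv : mu / lam = t⁻¹ := by rw [htdef, inv_div]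
  rw [hinv] at hW hWt ⊢
  have hz : ∀ k : ℤ, t ^ k * t ^ (-k) = 1 := fun k => by
    rw [← zpow_add₀ ht, add_neg_cancel, zpow_zero]
  have hz' : ∀ k : ℤ, t⁻¹ ^ k * t ^ k = 1 := fun k => by
    rw [inv_zpow', mul_comm, hz]
  -- averages of the section on both sides of an edge, at the foot and at the head
  let a : Γ.Edge → K := fun e => 1 / 2 * (t ^ (-Γ.cross e) * φ (.inr e) + φ (.inl e))
  let a' : Γ.Edge → K := fun e => 1 / 2 * (φ (.inr e) + t ^ Γ.cross e * φ (.inl e))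
  let W' : Γ.Edge → K := fun e => t⁻¹ ^ Γ.cross e * W e
  let T : Γ.Edge → K := fun e => W e * a e
  have ha' : ∀ e, a' e = t ^ Γ.cross e * a e := fun e => by
    have := hz (Γ.cross e)
    simp only [a, a']
    linear_combination (-1 / 2 * φ (.inr e)) * this
  -- `W` and φ have inverse monodromies, so their product may be read at the foot or at the head of
  -- an edge.
  have hT : ∀ e, T e = W' e * a' e := fun e => by
    rw [ha']
    simp only [T, W']
    linear_combination (-W e * a e) * hz' (Γ.cross e)
  have hjump : ∀ e, t ^ Γ.cross e * Γ.jump Γ.cross t φ e =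
      φ (.inr e) - t ^ Γ.cross e * φ (.inl e) := fun e => by
    rw [PerfectNetwork.jump_apply]
    linear_combination φ (.inr e) * hz (Γ.cross e)
  -- Let φ take the values r, m, l to the right of, between and to the left of the outgoing edges,
  -- with weights W₁, W₂. Then (W₁+W₂)(l+r)/2 − W₁(m+r)/2 − W₂(l+m)/2 = ½W₁(l−m) − ½W₂(m−r), and
  -- l−m, m−r are the jumps across the second and the first outgoing edge.
  have hwhite : ∀ w, 1 / 2 * (W (Γ.whiteOut w false) * Γ.jump Γ.cross t φ (Γ.whiteOut w true)) -
      1 / 2 * (W (Γ.whiteOut w true) * Γ.jump Γ.cross t φ (Γ.whiteOut w false)) =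
      T (Γ.whiteIn w) - (T (Γ.whiteOut w false) + T (Γ.whiteOut w true)) := fun w => by
    have h0 := congrFun hW (.inl w)
    rw [PerfectNetwork.twistedBoundary_inl, Pi.zero_apply] at h0
    rw [hT]
    simp only [T, W', a, a', PerfectNetwork.jump_apply, ← hφ.whiteOut_middle,
      ← hφ.whiteIn_left, ← hφ.whiteIn_right]
    linear_combination (-(1 / 2) * (φ (.inr (Γ.whiteIn w)) +
      φ (.inl (Γ.whiteOut w false)))) * h0
  -- The mirror computation, carried out at the heads of the incoming edges.
  have hblack : ∀ b, 1 / 2 * (W' (Γ.blackIn b false) *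
        (t ^ Γ.cross (Γ.blackIn b true) * Γ.jump Γ.cross t φ (Γ.blackIn b true))) -
      1 / 2 * (W' (Γ.blackIn b true) *
        (t ^ Γ.cross (Γ.blackIn b false) * Γ.jump Γ.cross t φ (Γ.blackIn b false))) =
      T (Γ.blackIn b false) + T (Γ.blackIn b true) - T (Γ.blackOut b) := fun b => by
    have h0 := congrFun hW (.inr b)
    rw [PerfectNetwork.twistedBoundary_inr, Pi.zero_apply] at h0
    rw [hT, hT, hjump, hjump]
    simp only [T, W', a, a', ← hφ.blackIn_middle, ← hφ.blackOut_left, ← hφ.blackOut_right]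
    linear_combination (-(1 / 2) * (φ (.inr (Γ.blackIn b false)) +
      φ (.inl (Γ.blackOut b)))) * h0
  have hsource : ∀ k', 1 / 2 * (t ^ (-Γ.cross (Γ.sourceEdge k')) * φ (.inr (Γ.sourceEdge k')) +
      φ (.inl (Γ.sourceEdge k'))) = rhoCoeff lam mu i k' * C := by
    refine boundary_average (lam := lam) hmu hne (R := fun k => φ (.inl (Γ.sourceEdge k)))
      (fun k' => ?_) hUs
    have hs := hφ.source (finRotate N k')
    rw [Equiv.symm_apply_apply, zpow_add₀ ht] at hs
    rw [hs, mul_right_comm, mul_comm]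
    congr 2
    obtain ⟨N, rfl⟩ : ∃ N', N = N' + 1 := ⟨N - 1, by have := i.pos; omega⟩
    by_cases hk : k' = Fin.last N
    · simp [hk]
    · have hk' : (k' : ℕ) ≠ N := fun h => hk (Fin.ext h)
      rw [coe_finRotate_of_ne_last hk]
      simp [hk']
  have hsink : ∀ j', 1 / 2 * (φ (.inr (Γ.sinkEdge j')) +
      t ^ Γ.cross (Γ.sinkEdge j') * φ (.inl (Γ.sinkEdge j'))) = rhoCoeff lam mu l j' * C' := by
    refine boundary_average (lam := lam) hmu hne (L := fun j => φ (.inr (Γ.sinkEdge j)))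
      (R := fun j => t ^ Γ.cross (Γ.sinkEdge j) * φ (.inl (Γ.sinkEdge j)))
      (fun j' => ?_) (fun j' => ?_)
    · rw [hφ.sink, ← htdef, zpow_add₀ ht]
      have : t ^ (if (j' : ℕ) + 1 = N then (1 : ℤ) else 0) *
          t ^ (if (j' : ℕ) + 1 = N then (-1 : ℤ) else 0) = 1 := by
        split_ifs
        · exact hz 1
        · simp
      linear_combination (-t ^ Γ.cross (Γ.sinkEdge j') * φ (.inl (Γ.sinkEdge j'))) * this
    · rw [← hUt j', hjump]
  -- The total of T over all edges, counted by starts and by ends; its internal parts differ by the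
  -- local pairings.
  have hsum := (Γ.sum_edge_start T).symm.trans (Γ.sum_edge_finish T)
  have hS : ∑ k', T (Γ.sourceEdge k') = rhoCoeff lam mu i k * (A * C) := by
    simp only [T, a, hsource, hWs, ite_mul, zero_mul, Finset.sum_ite_eq', Finset.mem_univ, if_true]
    ring
  have hE : ∑ j', T (Γ.sinkEdge j') = rhoCoeff lam mu l j * (A' * C') := by
    simp only [hT, W', a', hsink, hWt, ite_mul, zero_mul, Finset.sum_ite_eq', Finset.mem_univ,
      if_true]
    ring
  rw [Γ.sum_whiteCoeff fun e f => W e * Γ.jump Γ.cross t φ f,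
    Γ.sum_blackCoeff fun e f =>
      t⁻¹ ^ Γ.cross f * W f * (t ^ Γ.cross e * Γ.jump Γ.cross t φ e),
    Finset.sum_congr rfl fun w _ => hwhite w, Finset.sum_congr rfl fun b _ => hblack b,
    Finset.sum_sub_distrib, Finset.sum_sub_distrib, ← hS, ← hE]
  linear_combination -hsum

end IntersectionForm

end CylindricalNetwork

/-! ## Linearity of the outer and inner multiplications -/

section Multiplication

variable {K : Type*} [Field K] {V : Type*} [Quiver V]

theorem concat_ofPath_nil {a b : V} (f : PathHom K a b) :
    concat f (ofPath K (.nil : Quiver.Path b b)) = f := by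
  induction f using pathHom_induction with
  | h0 => simp
  | hadd x y hx hy => simp [hx, hy]
  | hsmul r x hx => simp [hx]
  | hp p => simp

theorem concat_nil_ofPath {a b : V} (f : PathHom K a b) :
    concat (ofPath K (.nil : Quiver.Path a a)) f = f := by
  induction f using pathHom_induction with
  | h0 => simp
  | hadd x y hx hy => simp only [map_add, hx, hy]
  | hsmul r x hx => simp only [map_smul, hx]
  | hp p => simp

@[simp]
theorem doubleBracket_nil_left (β : ArrowBracket K V) {a c d : V} (h : PathHom K c d) :
    doubleBracket β (ofPath K (.nil : Quiver.Path a a)) h = 0 := by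
  induction h using pathHom_induction with
  | h0 => simp
  | hadd x y hx hy => simp only [map_add, hx, hy, add_zero]
  | hsmul r x hx => simp only [map_smul, hx, smul_zero]
  | hp p => simp [pathPathBracket]

@[simp]
theorem doubleBracket_nil_right (β : ArrowBracket K V) {a b c : V} (f : PathHom K a b) :
    doubleBracket β f (ofPath K (.nil : Quiver.Path c c)) = 0 := by
  induction f using pathHom_induction with
  | h0 => simp
  | hadd x y hx hy => simp only [map_add, LinearMap.add_apply, hx, hy, add_zero]
  | hsmul r x hx => simp only [map_smul, LinearMap.smul_apply, hx, smul_zero]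
  | hp p =>
    rw [doubleBracket_ofPath]
    induction p with
    | nil => rfl
    | cons p e ih => simp [pathPathBracket, arrowPathBracket, ih]

/-- `mulRL f t` is linear in `f`. -/
def mulRLFlip {a b c d e : V} (t : PathHom K a b ⊗[K] PathHom K d e) :
    PathHom K b c →ₗ[K] PathHom K a c ⊗[K] PathHom K d e where
  toFun f := mulRL f t
  map_add' f g := by simp [mulRL, LinearMap.rTensor_add]
  map_smul' r f := by simp [mulRL, LinearMap.rTensor_smul]

/-- `mulRR f t` is linear in `f`. -/
def mulRRFlip {a b c d e : V} (t : PathHom K a b ⊗[K] PathHom K c d) :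
    PathHom K d e →ₗ[K] PathHom K a b ⊗[K] PathHom K c e where
  toFun f := mulRR f t
  map_add' f g := by simp [mulRR, LinearMap.lTensor_add]
  map_smul' r f := by simp [mulRR, LinearMap.lTensor_smul]

theorem mulRL_add {a b c d e : V} (f g : PathHom K b c) (t : PathHom K a b ⊗[K] PathHom K d e) :
    mulRL (f + g) t = mulRL f t + mulRL g t := map_add (mulRLFlip t) f g

theorem mulRR_add {a b c d e : V} (f g : PathHom K d e) (t : PathHom K a b ⊗[K] PathHom K c d) :
    mulRR (f + g) t = mulRR f t + mulRR g t := map_add (mulRRFlip t) f g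

theorem mulRL_sum {α : Type*} (s : Finset α) {a b c d e : V} (f : α → PathHom K b c)
    (t : PathHom K a b ⊗[K] PathHom K d e) :
    mulRL (∑ i ∈ s, f i) t = ∑ i ∈ s, mulRL (f i) t := map_sum (mulRLFlip t) f s

theorem mulRR_sum {α : Type*} (s : Finset α) {a b c d e : V} (f : α → PathHom K d e)
    (t : PathHom K a b ⊗[K] PathHom K c d) :
    mulRR (∑ i ∈ s, f i) t = ∑ i ∈ s, mulRR (f i) t := map_sum (mulRRFlip t) f s

@[simp]
theorem mulRL_zero {a b c d e : V} (t : PathHom K a b ⊗[K] PathHom K d e) :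
    mulRL (0 : PathHom K b c) t = 0 := map_zero (mulRLFlip t)

@[simp]
theorem mulRR_zero {a b c d e : V} (t : PathHom K a b ⊗[K] PathHom K c d) :
    mulRR (0 : PathHom K d e) t = 0 := map_zero (mulRRFlip t)

end Multiplication

namespace CylindricalNetwork

/-! ## Generating functions of paths -/

section PathSum

variable {N : ℕ} (Γ : CylindricalNetwork N N) {K : Type*} [Field K]

open Classical in
/-- The identity morphism if `u = v`, and `0` otherwise. -/
def deltaHom (K : Type*) [Field K] (u v : Γ.Vertex) :
    PathHom K (Γ.glueVertex u) (Γ.glueVertex v) :=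
  if h : u = v then h ▸ ofPath K .nil else 0

/-- The image of a path in the torus network. -/
def gluePath {u v : Γ.Vertex} (p : Quiver.Path u v) :
    Quiver.Path (Γ.glueVertex u) (Γ.glueVertex v) :=
  Γ.glue.mapPath p

/-- The image of an arrow in the torus network. -/
def glueHom {u v : Γ.Vertex} (e : u ⟶ v) : Γ.glueVertex u ⟶ Γ.glueVertex v :=
  Γ.glue.map e

theorem gluePath_toPath {u v : Γ.Vertex} (e : u ⟶ v) :
    Γ.gluePath e.toPath = (Γ.glueHom e).toPath := rfl

theorem gluePath_cons {u v w : Γ.Vertex} (p : Quiver.Path u v) (e : v ⟶ w) :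
    Γ.gluePath (p.cons e) = (Γ.gluePath p).comp (Γ.gluePath e.toPath) := rfl

/-- The weighted morphism of the torus network given by an edge. -/
def edgeHom (z : K) (e : Γ.Edge) :
    PathHom K (Γ.glueVertex (Γ.src e)) (Γ.glueVertex (Γ.tgt e)) :=
  z ^ Γ.cross e • ofPath K (Γ.gluePath (Quiver.Hom.toPath (⟨e, rfl, rfl⟩ : Γ.src e ⟶ Γ.tgt e)))

/-- The weighted sum of all paths from `u` to `v`. -/
def pathSum (z : K) (u v : Γ.Vertex) : PathHom K (Γ.glueVertex u) (Γ.glueVertex v) :=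
  ∑ᶠ p : Quiver.Path u v, z ^ Γ.crossing p • ofPath K (Γ.gluePath p)

@[simp]
theorem deltaHom_self (u : Γ.Vertex) : Γ.deltaHom K u u = ofPath K .nil := by
  simp [deltaHom]

theorem deltaHom_of_ne {u v : Γ.Vertex} (h : u ≠ v) : Γ.deltaHom K u v = 0 := by
  simp [deltaHom, h]

theorem doubleBracket_deltaHom_left (β : ArrowBracket K Γ.TorusVertex) (u v : Γ.Vertex)
    {c d : Γ.TorusVertex} (h : PathHom K c d) : doubleBracket β (Γ.deltaHom K u v) h = 0 := by
  by_cases huv : u = v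
  · subst huv
    simp
  · simp [Γ.deltaHom_of_ne huv]

theorem doubleBracket_deltaHom_right (β : ArrowBracket K Γ.TorusVertex) {a b : Γ.TorusVertex}
    (f : PathHom K a b) (u v : Γ.Vertex) : doubleBracket β f (Γ.deltaHom K u v) = 0 := by
  by_cases huv : u = v
  · subst huv
    simp
  · simp [Γ.deltaHom_of_ne huv]

/-- A path is trivial or ends with an edge. -/
def pathEquiv (u v : Γ.Vertex) : (PLift (u = v) ⊕
    Σ e : Γ.Edge, Σ _ : PLift (Γ.tgt e = v), Quiver.Path u (Γ.src e)) ≃ Quiver.Path u v where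
  toFun x := match x with
    | .inl h => h.down ▸ .nil
    | .inr ⟨e, h, p⟩ => p.cons (⟨e, rfl, h.down⟩ : Γ.src e ⟶ v)
  invFun p := match p with
    | .nil => .inl ⟨rfl⟩
    | .cons p e => .inr ⟨e.1, ⟨e.2.2⟩, e.2.1.symm ▸ p⟩
  left_inv x := by
    rcases x with ⟨⟨rfl⟩⟩ | ⟨e, ⟨rfl⟩, p⟩ <;> rfl
  right_inv p := by
    cases p with
    | nil => rfl
    | cons p e =>
      obtain ⟨e, rfl, rfl⟩ := e
      rfl

theorem crossing_cons {u v w : Γ.Vertex} (p : Quiver.Path u v) (e : v ⟶ w) :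
    Γ.crossing (p.cons e) = Γ.crossing p + Γ.cross e.1 := by
  simp [crossing, Quiver.Path.addWeight_cons]

/-- Decomposition of paths according to the last edge. -/
theorem pathSum_eq_last {z : K} (hz : z ≠ 0) (u v : Γ.Vertex) :
    Γ.pathSum z u v = Γ.deltaHom K u v + ∑ e, concat (Γ.pathSum z u (Γ.src e))
      (concat (Γ.edgeHom z e) (Γ.deltaHom K (Γ.tgt e) v)) := by
  classical
  have hfin : ∀ u v : Γ.Vertex, Fintype (Quiver.Path u v) := fun u v => Fintype.ofFinite _
  unfold pathSum
  simp only [finsum_eq_sum_of_fintype]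
  rw [← Equiv.sum_comp (Γ.pathEquiv u v), Fintype.sum_sum_type, Fintype.sum_sigma]
  congr 1
  · by_cases h : u = v
    · subst h
      simp [pathEquiv, crossing, gluePath]
      rfl
    · have : IsEmpty (PLift (u = v)) := ⟨fun x => h x.down⟩
      simp [Γ.deltaHom_of_ne h]
  · refine Finset.sum_congr rfl fun e _ => ?_
    rw [Fintype.sum_sigma]
    by_cases h : Γ.tgt e = v
    · subst h
      rw [Fintype.sum_subsingleton _ ⟨rfl⟩, map_sum, LinearMap.sum_apply]
      refine Finset.sum_congr rfl fun p _ => ?_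
      simp only [pathEquiv, Equiv.coe_fn_mk, crossing_cons, deltaHom_self, concat_ofPath_nil,
        edgeHom, map_smul, LinearMap.smul_apply, smul_smul, concat_ofPath, zpow_add₀ hz, gluePath_cons]
      rw [mul_comm]
    · have : IsEmpty (PLift (Γ.tgt e = v)) := ⟨fun x => h x.down⟩
      simp [Γ.deltaHom_of_ne h]

/-- Decomposition of paths according to the first edge. -/
theorem pathSum_eq_first {z : K} (hz : z ≠ 0) (u v : Γ.Vertex) :
    Γ.pathSum z u v = Γ.deltaHom K u v + ∑ e, concat (Γ.deltaHom K u (Γ.src e))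
      (concat (Γ.edgeHom z e) (Γ.pathSum z (Γ.tgt e) v)) := by
  -- Paths grow at their end, so the first edge is isolated by induction on the endpoint: expanding
  -- the initial piece by its first edge, and the tail by its last edge, gives the same double sum
  -- in opposite orders.
  induction v using Γ.acyclic.wellFounded.induction with
  | _ v ih =>
  have h1 : ∀ e, concat (Γ.pathSum z u (Γ.src e))
      (concat (Γ.edgeHom z e) (Γ.deltaHom K (Γ.tgt e) v)) =
      concat (Γ.deltaHom K u (Γ.src e)) (concat (Γ.edgeHom z e) (Γ.deltaHom K (Γ.tgt e) v)) +
      ∑ f, concat (Γ.deltaHom K u (Γ.src f)) (concat (Γ.edgeHom z f)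
        (concat (Γ.pathSum z (Γ.tgt f) (Γ.src e))
          (concat (Γ.edgeHom z e) (Γ.deltaHom K (Γ.tgt e) v)))) := fun e => by
    by_cases h : Γ.tgt e = v
    · rw [ih _ ⟨e, rfl, h⟩]
      simp only [map_add, LinearMap.add_apply, map_sum, LinearMap.sum_apply, concat_assoc]
    · simp [Γ.deltaHom_of_ne h]
  rw [Γ.pathSum_eq_last hz u v, Finset.sum_congr rfl fun e _ => h1 e]
  have h2 : ∀ e, concat (Γ.deltaHom K u (Γ.src e))
      (concat (Γ.edgeHom z e) (Γ.pathSum z (Γ.tgt e) v)) =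
      concat (Γ.deltaHom K u (Γ.src e)) (concat (Γ.edgeHom z e) (Γ.deltaHom K (Γ.tgt e) v)) +
      ∑ f, concat (Γ.deltaHom K u (Γ.src e)) (concat (Γ.edgeHom z e)
        (concat (Γ.pathSum z (Γ.tgt e) (Γ.src f))
          (concat (Γ.edgeHom z f) (Γ.deltaHom K (Γ.tgt f) v)))) := fun e => by
    rw [Γ.pathSum_eq_last hz (Γ.tgt e) v]
    simp only [map_add, map_sum]
  rw [Finset.sum_congr rfl fun e _ => h2 e, Finset.sum_add_distrib, Finset.sum_add_distrib,
    Finset.sum_comm]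

/-- The double bracket with a generating function of paths in the first argument. -/
theorem doubleBracket_pathSum_left (β : ArrowBracket K Γ.TorusVertex) {z : K} (hz : z ≠ 0)
    (u v : Γ.Vertex) {c d : Γ.TorusVertex} (h : PathHom K c d) :
    doubleBracket β (Γ.pathSum z u v) h =
      ∑ e, mulLR (Γ.pathSum z u (Γ.src e)) (mulRL (Γ.pathSum z (Γ.tgt e) v)
        (doubleBracket β (Γ.edgeHom z e) h)) := by
  -- Leibniz splits off the last edge and the induction hypothesis treats what precedes it; the
  -- tails behind a given edge then reassemble by their own last edges.
  induction v using Γ.acyclic.wellFounded.induction with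
  | _ v ih =>
  have h1 : ∀ e, doubleBracket β (concat (Γ.pathSum z u (Γ.src e))
      (concat (Γ.edgeHom z e) (Γ.deltaHom K (Γ.tgt e) v))) h =
      mulLR (Γ.pathSum z u (Γ.src e)) (mulRL (Γ.deltaHom K (Γ.tgt e) v)
        (doubleBracket β (Γ.edgeHom z e) h)) +
      ∑ f, mulLR (Γ.pathSum z u (Γ.src f)) (mulRL (concat (Γ.pathSum z (Γ.tgt f) (Γ.src e))
          (concat (Γ.edgeHom z e) (Γ.deltaHom K (Γ.tgt e) v)))
        (doubleBracket β (Γ.edgeHom z f) h)) := fun e => by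
    by_cases hv : Γ.tgt e = v
    · rw [doubleBracket_concat_left, doubleBracket_concat_left, doubleBracket_deltaHom_left,
        ih _ ⟨e, rfl, hv⟩]
      simp only [map_zero, zero_add, map_sum, ← mulLR_mulRL, mulRL_comp]
    · simp [Γ.deltaHom_of_ne hv]
  have h2 : ∀ e, mulLR (Γ.pathSum z u (Γ.src e)) (mulRL (Γ.pathSum z (Γ.tgt e) v)
      (doubleBracket β (Γ.edgeHom z e) h)) =
      mulLR (Γ.pathSum z u (Γ.src e)) (mulRL (Γ.deltaHom K (Γ.tgt e) v)
        (doubleBracket β (Γ.edgeHom z e) h)) +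
      ∑ f, mulLR (Γ.pathSum z u (Γ.src e)) (mulRL (concat (Γ.pathSum z (Γ.tgt e) (Γ.src f))
          (concat (Γ.edgeHom z f) (Γ.deltaHom K (Γ.tgt f) v)))
        (doubleBracket β (Γ.edgeHom z e) h)) := fun e => by
    rw [Γ.pathSum_eq_last hz (Γ.tgt e) v, mulRL_add, mulRL_sum, map_add, map_sum]
  rw [Γ.pathSum_eq_last hz u v, map_add, LinearMap.add_apply, doubleBracket_deltaHom_left, zero_add,
    map_sum, LinearMap.sum_apply, Finset.sum_congr rfl fun e _ => h1 e,
    Finset.sum_congr rfl fun e _ => h2 e, Finset.sum_add_distrib, Finset.sum_add_distrib,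
    Finset.sum_comm]

/-- The double bracket with a generating function of paths in the second argument. -/
theorem doubleBracket_pathSum_right (β : ArrowBracket K Γ.TorusVertex) {z : K} (hz : z ≠ 0)
    {a b : Γ.TorusVertex} (h : PathHom K a b) (u v : Γ.Vertex) :
    doubleBracket β h (Γ.pathSum z u v) =
      ∑ e, mulLL (Γ.pathSum z u (Γ.src e)) (mulRR (Γ.pathSum z (Γ.tgt e) v)
        (doubleBracket β h (Γ.edgeHom z e))) := by
  induction v using Γ.acyclic.wellFounded.induction with
  | _ v ih =>
  have h1 : ∀ e, doubleBracket β h (concat (Γ.pathSum z u (Γ.src e))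
      (concat (Γ.edgeHom z e) (Γ.deltaHom K (Γ.tgt e) v))) =
      mulLL (Γ.pathSum z u (Γ.src e)) (mulRR (Γ.deltaHom K (Γ.tgt e) v)
        (doubleBracket β h (Γ.edgeHom z e))) +
      ∑ f, mulLL (Γ.pathSum z u (Γ.src f)) (mulRR (concat (Γ.pathSum z (Γ.tgt f) (Γ.src e))
          (concat (Γ.edgeHom z e) (Γ.deltaHom K (Γ.tgt e) v)))
        (doubleBracket β h (Γ.edgeHom z f))) := fun e => by
    by_cases hv : Γ.tgt e = v
    · rw [doubleBracket_concat_right, doubleBracket_concat_right, doubleBracket_deltaHom_right,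
        ih _ ⟨e, rfl, hv⟩]
      simp only [map_zero, zero_add, map_sum, ← mulLL_mulRR, mulRR_comp]
    · simp [Γ.deltaHom_of_ne hv]
  have h2 : ∀ e, mulLL (Γ.pathSum z u (Γ.src e)) (mulRR (Γ.pathSum z (Γ.tgt e) v)
      (doubleBracket β h (Γ.edgeHom z e))) =
      mulLL (Γ.pathSum z u (Γ.src e)) (mulRR (Γ.deltaHom K (Γ.tgt e) v)
        (doubleBracket β h (Γ.edgeHom z e))) +
      ∑ f, mulLL (Γ.pathSum z u (Γ.src e)) (mulRR (concat (Γ.pathSum z (Γ.tgt e) (Γ.src f))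
          (concat (Γ.edgeHom z f) (Γ.deltaHom K (Γ.tgt f) v)))
        (doubleBracket β h (Γ.edgeHom z e))) := fun e => by
    rw [Γ.pathSum_eq_last hz (Γ.tgt e) v, mulRR_add, mulRR_sum, map_add, map_sum]
  rw [Γ.pathSum_eq_last hz u v, map_add, doubleBracket_deltaHom_right, zero_add,
    map_sum, Finset.sum_congr rfl fun e _ => h1 e,
    Finset.sum_congr rfl fun e _ => h2 e, Finset.sum_add_distrib, Finset.sum_add_distrib,
    Finset.sum_comm]

end PathSum

end CylindricalNetwork

theorem doubleBracket_toPath {K : Type*} [Field K] {V : Type*} [Quiver V] (β : ArrowBracket K V)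
    {a b c d : V} (e : a ⟶ b) (f : c ⟶ d) :
    doubleBracket β (ofPath K e.toPath) (ofPath K f.toPath) = β e f := by
  rw [doubleBracket_ofPath]
  simp [Quiver.Hom.toPath, pathPathBracket, arrowPathBracket, mulLR_nil, mulLL_nil]

/-- Tensors of linear combinations of paths are determined by their coordinates. -/
theorem tensor_ext {K α α' : Type*} [Field K] {s t : (α →₀ K) ⊗[K] (α' →₀ K)}
    (h : ∀ p q, finsuppTensorFinsupp' K α α' s (p, q) = finsuppTensorFinsupp' K α α' t (p, q)) :
    s = t :=
  (finsuppTensorFinsupp' K α α').injective (Finsupp.ext fun x => h x.1 x.2)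

namespace CylindricalNetwork

/-! ### Tail exchange, and path sums whose spectral parameter changes at an edge. -/

section Flow

variable {N : ℕ} (Γ : CylindricalNetwork N N) {K : Type*} [Field K]

theorem whiteCoeff_of_src_ne {e f : Γ.Edge} (h : Γ.src e ≠ Γ.src f) : Γ.whiteCoeff K e f = 0 := by
  rcases Γ.edge_start_cases e with ⟨i, rfl⟩ | ⟨w, _ | _, rfl⟩ | ⟨b, rfl⟩ <;>
  rcases Γ.edge_start_cases f with ⟨i', rfl⟩ | ⟨w', _ | _, rfl⟩ | ⟨b', rfl⟩ <;>
  simp_all [whiteCoeff]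

theorem blackCoeff_of_tgt_ne {e f : Γ.Edge} (h : Γ.tgt e ≠ Γ.tgt f) : Γ.blackCoeff K e f = 0 := by
  rcases Γ.edge_finish_cases e with ⟨i, rfl⟩ | ⟨w, rfl⟩ | ⟨b, _ | _, rfl⟩ <;>
  rcases Γ.edge_finish_cases f with ⟨i', rfl⟩ | ⟨w', rfl⟩ | ⟨b', _ | _, rfl⟩ <;>
  simp_all [blackCoeff]

/-- The outer and inner multiplications place the four remaining path pieces so that the paths
exchange tails at the common vertex: the left factor starts like the second path and ends like the
first, the right factor the other way round. -/
theorem mul_edgeBracket {p q r s : Γ.TorusVertex}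
    (A : ∀ x, PathHom K p (Γ.glueVertex x)) (B : ∀ x, PathHom K (Γ.glueVertex x) q)
    (C : ∀ x, PathHom K r (Γ.glueVertex x)) (D : ∀ x, PathHom K (Γ.glueVertex x) s)
    {u v u' v' : Γ.Vertex} (e : u ⟶ v) (f : u' ⟶ v') :
    mulLR (A u) (mulRL (B v) (mulLL (C u') (mulRR (D v')
      (Γ.edgeBracket K (Γ.glueHom e) (Γ.glueHom f))))) =
    Γ.whiteCoeff K e.1 f.1 •
      (concat (concat (C u) (ofPath K (Γ.gluePath e.toPath))) (B v) ⊗ₜ[K]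
        concat (concat (A u') (ofPath K (Γ.gluePath f.toPath))) (D v')) +
    Γ.blackCoeff K e.1 f.1 •
      (concat (concat (C u') (ofPath K (Γ.gluePath f.toPath))) (B v') ⊗ₜ[K]
        concat (concat (A u) (ofPath K (Γ.gluePath e.toPath))) (D v)) := by
  unfold edgeBracket
  simp only [map_add]
  congr 1
  · by_cases h : u = u'
    · subst h
      rw [dif_pos rfl]
      simp only [map_smul, mulLR, mulRL, mulLL, mulRR, LinearMap.lTensor_tmul,
        LinearMap.rTensor_tmul, LinearMap.flip_apply, concat_assoc]
      rfl
    -- Coincidences created by the gluing are harmless: the coefficient vanishes unless the edges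
    -- share a start in the cylinder itself.
    · have h0 : Γ.whiteCoeff K e.1 f.1 = 0 := Γ.whiteCoeff_of_src_ne (by rwa [e.2.1, f.2.1])
      have h1 : Γ.whiteCoeff K (Γ.glueHom e).1 (Γ.glueHom f).1 = 0 := h0
      rw [h1, h0]
      split_ifs <;> simp
  · by_cases h : v = v'
    · subst h
      rw [dif_pos rfl]
      simp only [map_smul, mulLR, mulRL, mulLL, mulRR, LinearMap.lTensor_tmul,
        LinearMap.rTensor_tmul, LinearMap.flip_apply, concat_assoc]
      rfl
    · have h0 : Γ.blackCoeff K e.1 f.1 = 0 := Γ.blackCoeff_of_tgt_ne (by rwa [e.2.2, f.2.2])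
      have h1 : Γ.blackCoeff K (Γ.glueHom e).1 (Γ.glueHom f).1 = 0 := h0
      rw [h1, h0]
      split_ifs <;> simp

/-- The weighted sum of the paths from `u` to `v` through the edge `e`, with weight `z` before
`e`, and `z'` from `e` on. -/
def flow (z z' : K) (u v : Γ.Vertex) (e : Γ.Edge) :
    PathHom K (Γ.glueVertex u) (Γ.glueVertex v) :=
  concat (concat (Γ.pathSum z u (Γ.src e)) (Γ.edgeHom z' e)) (Γ.pathSum z' (Γ.tgt e) v)

theorem edgeHom_eq_smul {z z' : K} (hz' : z' ≠ 0) (e : Γ.Edge) :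
    Γ.edgeHom z e = (z / z') ^ Γ.cross e • Γ.edgeHom z' e := by
  rw [edgeHom, edgeHom, smul_smul, div_zpow, div_mul_cancel₀ _ (zpow_ne_zero _ hz')]

/-- The scalar replaces the weight `z'` of `e` by `z`, which moves the change of parameter from the
foot of `e` to its head. -/
theorem smul_flow {z z' : K} (hz' : z' ≠ 0) (u v : Γ.Vertex) (e : Γ.Edge) :
    (z / z') ^ Γ.cross e • Γ.flow z z' u v e =
      concat (concat (Γ.pathSum z u (Γ.src e)) (Γ.edgeHom z e)) (Γ.pathSum z' (Γ.tgt e) v) := by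
  rw [Γ.edgeHom_eq_smul (z := z) hz']
  simp only [flow, map_smul, LinearMap.smul_apply]

open Classical in
-- Grouping by the edge taken out of `x` collects all paths through `x` that change parameter there;
-- subtracting the identity removes those that stop at `x`. Matched with `sum_flow_in`, this gives
-- conservation of the flow at internal vertices.
theorem sum_flow_out {z z' : K} (hz' : z' ≠ 0) (u v x : Γ.Vertex) :
    ∑ e, (if Γ.src e = x then Γ.flow z z' u v e else 0) =
      concat (Γ.pathSum z u x) (Γ.pathSum z' x v - Γ.deltaHom K x v) := by
  rw [Γ.pathSum_eq_first hz' x v, add_sub_cancel_left, map_sum]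
  refine Finset.sum_congr rfl fun e _ => ?_
  split_ifs with h
  · subst h
    rw [deltaHom_self, concat_nil_ofPath, flow, concat_assoc]
  · rw [Γ.deltaHom_of_ne (Ne.symm h)]
    simp

open Classical in
theorem sum_flow_in {z z' : K} (hz : z ≠ 0) (hz' : z' ≠ 0) (u v x : Γ.Vertex) :
    ∑ e, (if Γ.tgt e = x then (z / z') ^ Γ.cross e • Γ.flow z z' u v e else 0) =
      concat (Γ.pathSum z u x - Γ.deltaHom K u x) (Γ.pathSum z' x v) := by
  rw [Γ.pathSum_eq_last hz u x, add_sub_cancel_left, map_sum, LinearMap.sum_apply]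
  refine Finset.sum_congr rfl fun e _ => ?_
  split_ifs with h
  · subst h
    rw [deltaHom_self, concat_ofPath_nil, Γ.smul_flow hz']
  · rw [Γ.deltaHom_of_ne h]
    simp

theorem pathSum_source {z : K} (u : Γ.Vertex) (hz : z ≠ 0) (i : Fin N) :
    Γ.pathSum z u (.source i) = Γ.deltaHom K u (.source i) := by
  rw [Γ.pathSum_eq_last hz, add_eq_left]
  refine Finset.sum_eq_zero fun e _ => ?_
  rw [Γ.deltaHom_of_ne, map_zero, map_zero]
  rcases Γ.edge_finish_cases e with ⟨i, rfl⟩ | ⟨w, rfl⟩ | ⟨b, _, rfl⟩ <;> simp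

theorem pathSum_sink {z : K} (v : Γ.Vertex) (hz : z ≠ 0) (j : Fin N) :
    Γ.pathSum z (.sink j) v = Γ.deltaHom K (.sink j) v := by
  rw [Γ.pathSum_eq_first hz, add_eq_left]
  refine Finset.sum_eq_zero fun e _ => ?_
  rw [Γ.deltaHom_of_ne, map_zero, LinearMap.zero_apply]
  rcases Γ.edge_start_cases e with ⟨i, rfl⟩ | ⟨w, _, rfl⟩ | ⟨b, rfl⟩ <;> simp

variable {z z' : K} (hz : z ≠ 0) (hz' : z' ≠ 0) (k j : Fin N)
include hz hz'

/-- The change happens before the first edge, so the whole path carries `z'`; only the edge at the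
starting source can occur. -/
theorem flow_sourceEdge (k' : Fin N) :
    Γ.flow z z' (.source k) (.sink j) (Γ.sourceEdge k') =
      if k' = k then Γ.pathSum z' (.source k) (.sink j) else 0 := by
  classical
  have h := Γ.sum_flow_out (z := z) hz' (.source k) (.sink j) (.source k')
  rw [Γ.sum_edge_start, Γ.deltaHom_of_ne (by simp), sub_zero, Γ.pathSum_source _ hz] at h
  simp only [PerfectNetwork.src_sourceEdge, PerfectNetwork.src_whiteOut,
    PerfectNetwork.src_blackOut, PerfectNetwork.Vertex.source.injEq, reduceCtorEq, if_false,
    Finset.sum_const_zero, add_zero, Finset.sum_ite_eq', Finset.mem_univ, if_true] at h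
  rw [h]
  split_ifs with hk
  · subst hk
    rw [deltaHom_self, concat_nil_ofPath]
  · rw [Γ.deltaHom_of_ne (by simpa using Ne.symm hk)]
    simp

/-- Read at the head of the last edge, the change comes after everything, so the whole path carries
`z`. -/
theorem flow_sinkEdge (j' : Fin N) :
    (z / z') ^ Γ.cross (Γ.sinkEdge j') •
      Γ.flow z z' (.source k) (.sink j) (Γ.sinkEdge j') =
      if j' = j then Γ.pathSum z (.source k) (.sink j) else 0 := by
  classical
  have h := Γ.sum_flow_in hz hz' (.source k) (.sink j) (.sink j')
  rw [Γ.sum_edge_finish, Γ.deltaHom_of_ne (by simp), sub_zero, Γ.pathSum_sink _ hz'] at h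
  simp only [PerfectNetwork.tgt_sinkEdge, PerfectNetwork.tgt_whiteIn,
    PerfectNetwork.tgt_blackIn, PerfectNetwork.Vertex.sink.injEq, reduceCtorEq, if_false,
    Finset.sum_const_zero, add_zero, Finset.sum_ite_eq', Finset.mem_univ, if_true] at h
  rw [h]
  split_ifs with hk
  · subst hk
    rw [deltaHom_self, concat_ofPath_nil]
  · rw [Γ.deltaHom_of_ne (by simpa using hk)]
    simp

/-- The coordinates of the flow are twisted cycles. -/
theorem twistedBoundary_flow (P : Quiver.Path (Γ.marked k) (Γ.marked j)) :
    Γ.twistedBoundary Γ.cross (z / z')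
      (fun e => (Γ.flow z z' (.source k) (.sink j) e : PathHom K (Γ.marked k) (Γ.marked j)) P) =
      0 := by
  classical
  have h : ∀ x, PerfectNetwork.Vertex.source k ≠ x → x ≠ .sink j →
      ∑ e, (if Γ.tgt e = x then
        (z / z') ^ Γ.cross e • Γ.flow z z' (.source k) (.sink j) e else 0) =
      ∑ e, (if Γ.src e = x then Γ.flow z z' (.source k) (.sink j) e else 0) := by
    intro x hk hj
    rw [Γ.sum_flow_in hz hz', Γ.sum_flow_out hz', Γ.deltaHom_of_ne hk, Γ.deltaHom_of_ne hj,
      sub_zero, sub_zero]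
  ext (w | b)
  · have hw := h (.white w) (by simp) (by simp)
    replace hw := (Γ.sum_edge_finish _).symm.trans (hw.trans (Γ.sum_edge_start _))
    simp only [PerfectNetwork.tgt_sinkEdge, PerfectNetwork.tgt_whiteIn,
      PerfectNetwork.tgt_blackIn, PerfectNetwork.src_sourceEdge, PerfectNetwork.src_whiteOut,
      PerfectNetwork.src_blackOut, PerfectNetwork.Vertex.white.injEq, reduceCtorEq, if_false,
      Finset.sum_const_zero, add_zero, zero_add, Finset.sum_add_distrib, Finset.sum_ite_eq',
      Finset.mem_univ, if_true] at hw
    exact sub_eq_zero.2 (DFunLike.congr_fun hw P)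
  · have hb := h (.black b) (by simp) (by simp)
    replace hb := (Γ.sum_edge_finish _).symm.trans (hb.trans (Γ.sum_edge_start _))
    simp only [PerfectNetwork.tgt_sinkEdge, PerfectNetwork.tgt_whiteIn,
      PerfectNetwork.tgt_blackIn, PerfectNetwork.src_sourceEdge, PerfectNetwork.src_whiteOut,
      PerfectNetwork.src_blackOut, PerfectNetwork.Vertex.black.injEq, reduceCtorEq, if_false,
      Finset.sum_const_zero, add_zero, zero_add, Finset.sum_add_distrib, Finset.sum_ite_eq',
      Finset.mem_univ, if_true] at hb
    exact sub_eq_zero.2 (DFunLike.congr_fun hb P)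

end Flow

/-! ## The quadratic bracket of boundary measurements -/

section RMatrix

variable {N : ℕ} (Γ : CylindricalNetwork N N) {K : Type*} [Field K] {lam mu : K}

/-- Leibniz in both arguments leaves edge pairs, and the tail exchange mixes the parameters. At a
white vertex the change occurs at the foot of the outgoing edge. At a black vertex it occurs at the
head of the incoming edge, which accounts for the extra powers. -/
theorem doubleBracket_pathSum (hlam : lam ≠ 0) (hmu : mu ≠ 0) (u v u' v' : Γ.Vertex) :
    doubleBracket (Γ.edgeBracket K) (Γ.pathSum lam u v) (Γ.pathSum mu u' v') =
      ∑ e, ∑ f, (Γ.whiteCoeff K e f • (Γ.flow mu lam u' v e ⊗ₜ[K] Γ.flow lam mu u v' f) +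
        Γ.blackCoeff K e f • (((mu / lam) ^ Γ.cross f • Γ.flow mu lam u' v f) ⊗ₜ[K]
          ((lam / mu) ^ Γ.cross e • Γ.flow lam mu u v' e))) := by
  rw [Γ.doubleBracket_pathSum_left _ hlam]
  refine Finset.sum_congr rfl fun e _ => ?_
  rw [Γ.doubleBracket_pathSum_right _ hmu, map_sum, map_sum]
  refine Finset.sum_congr rfl fun f _ => ?_
  have hb : doubleBracket (Γ.edgeBracket K) (Γ.edgeHom lam e) (Γ.edgeHom mu f) =
      (lam ^ Γ.cross e * mu ^ Γ.cross f) •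
        Γ.edgeBracket K (Γ.glueHom (⟨e, rfl, rfl⟩ : Γ.src e ⟶ Γ.tgt e))
          (Γ.glueHom (⟨f, rfl, rfl⟩ : Γ.src f ⟶ Γ.tgt f)) := by
    rw [← doubleBracket_toPath (Γ.edgeBracket K), edgeHom, edgeHom, map_smul, map_smul,
      LinearMap.smul_apply, smul_smul, mul_comm, gluePath_toPath, gluePath_toPath]
  have key := Γ.mul_edgeBracket (Γ.pathSum lam u) (fun x => Γ.pathSum lam x v)
    (Γ.pathSum mu u') (fun x => Γ.pathSum mu x v')
    (⟨e, rfl, rfl⟩ : Γ.src e ⟶ Γ.tgt e) (⟨f, rfl, rfl⟩ : Γ.src f ⟶ Γ.tgt f)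
  rw [hb, map_smul, map_smul, map_smul, map_smul]
  refine (congrArg _ key).trans ?_
  rw [Γ.smul_flow hlam, Γ.smul_flow hmu]
  simp only [flow, edgeHom, map_smul, LinearMap.smul_apply, TensorProduct.smul_tmul',
    TensorProduct.tmul_smul, smul_add, smul_smul]
  congr 2 <;> ring_nf

theorem doubleBracket_pathSum_apply (hlam : lam ≠ 0) (hmu : mu ≠ 0) (u v u' v' : Γ.Vertex)
    (P : Quiver.Path (Γ.glueVertex u') (Γ.glueVertex v))
    (Q : Quiver.Path (Γ.glueVertex u) (Γ.glueVertex v')) :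
    finsuppTensorFinsupp' K _ _
      (doubleBracket (Γ.edgeBracket K) (Γ.pathSum lam u v) (Γ.pathSum mu u' v')) (P, Q) =
      ∑ e, ∑ f, Γ.whiteCoeff K e f * (Γ.flow mu lam u' v e P * Γ.flow lam mu u v' f Q) +
      ∑ e, ∑ f, Γ.blackCoeff K e f * ((mu / lam) ^ Γ.cross f * Γ.flow mu lam u' v f P *
        ((lam / mu) ^ Γ.cross e * Γ.flow lam mu u v' e Q)) := by
  rw [Γ.doubleBracket_pathSum hlam hmu]
  simp only [map_sum, map_add, map_smul, Finsupp.coe_finsetSum, Finset.sum_apply,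
    Finsupp.add_apply, Finsupp.smul_apply, smul_eq_mul, finsuppTensorFinsupp'_apply_apply,
    Finset.sum_add_distrib]

/-- The double bracket of the entries of the boundary measurement matrices is given by the
trigonometric r-matrix. -/
theorem doubleBracket_boundaryMeasurement [CharZero K] (hlam : lam ≠ 0) (hmu : mu ≠ 0) (hne : lam ≠ mu)
    (i j k l : Fin N) :
    doubleBracket (Γ.edgeBracket K) (Γ.boundaryMeasurement lam i j)
      (Γ.boundaryMeasurement mu k l) =
      rhoCoeff lam mu i k • (Γ.boundaryMeasurement lam k j ⊗ₜ[K] Γ.boundaryMeasurement mu i l) -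
      rhoCoeff lam mu l j •
        (Γ.boundaryMeasurement mu k j ⊗ₜ[K] Γ.boundaryMeasurement lam i l) := by
  -- Coordinatewise at P ⊗ Q both flows become scalar twisted cycles, ready for `intersection_form`.
  refine tensor_ext fun P Q => ?_
  refine (Γ.doubleBracket_pathSum_apply hlam hmu (.source i) (.sink j) (.source k) (.sink l)
    P Q).trans ?_
  have key := Γ.intersection_form hlam hmu hne (Γ.twistedBoundary_flow hmu hlam k j P)
    (Γ.twistedBoundary_flow hlam hmu i l Q) (i := i) (j := j) (k := k) (l := l)
    (A := Γ.boundaryMeasurement lam k j P) (A' := Γ.boundaryMeasurement mu k j P)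
    (C := Γ.boundaryMeasurement mu i l Q) (C' := Γ.boundaryMeasurement lam i l Q)
    (fun k' => by
      rw [Γ.flow_sourceEdge hmu hlam]
      split_ifs <;> rfl)
    (fun j' => by
      refine (DFunLike.congr_fun (Γ.flow_sinkEdge hmu hlam k j j') P).trans ?_
      split_ifs <;> rfl)
    (fun i' => by
      rw [Γ.flow_sourceEdge hlam hmu]
      split_ifs <;> rfl)
    (fun l' => by
      refine (DFunLike.congr_fun (Γ.flow_sinkEdge hlam hmu i l l') Q).trans ?_
      split_ifs <;> rfl)
  simp only [map_sub, map_smul, Finsupp.sub_apply, Finsupp.smul_apply, smul_eq_mul,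
    finsuppTensorFinsupp'_apply_apply]
  exact key

end RMatrix

end CylindricalNetwork

/-! ## Polynomials in a matrix and brackets of their traces -/

section MatrixCalculus

open Polynomial

variable {K : Type*} [Field K] {V : Type*} [Quiver V] {ι : Type*} {obj : ι → V}

theorem identityMatrix_self [DecidableEq ι] (i : ι) : identityMatrix obj K i i = ofPath K .nil := by
  simp [identityMatrix]

theorem identityMatrix_of_ne [DecidableEq ι] {i j : ι} (h : i ≠ j) : identityMatrix obj K i j = 0 := by
  simp [identityMatrix, h]

variable [Fintype ι]

/-- The product of matrices over the path category. -/
def matrixMul : PathMatrix K obj →ₗ[K] PathMatrix K obj →ₗ[K] PathMatrix K obj :=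
  LinearMap.mk₂ K (fun A B i j => ∑ k, concat (A i k) (B k j))
    (fun A A' B => by
      ext1 i; ext1 j
      simp only [Pi.add_apply, map_add, LinearMap.add_apply, Finset.sum_add_distrib])
    (fun r A B => by
      ext1 i; ext1 j
      simp only [Pi.smul_apply, map_smul, LinearMap.smul_apply, Finset.smul_sum])
    (fun A B B' => by
      ext1 i; ext1 j
      simp only [Pi.add_apply, map_add, Finset.sum_add_distrib])
    (fun r A B => by
      ext1 i; ext1 j
      simp only [Pi.smul_apply, map_smul, Finset.smul_sum])

theorem matrixMul_apply (A B : PathMatrix K obj) (i j : ι) :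
    matrixMul A B i j = ∑ k, concat (A i k) (B k j) := rfl

theorem matrixMul_assoc (A B C : PathMatrix K obj) :
    matrixMul (matrixMul A B) C = matrixMul A (matrixMul B C) := by
  ext1 i; ext1 j
  simp only [matrixMul_apply, map_sum, LinearMap.sum_apply, concat_assoc]
  exact Finset.sum_comm

/-! ### Differentiating traces. -/

variable (β : ArrowBracket K V) {c d : V} (h : PathHom K c d)

/-- The sum of the brackets of the entries of `Z` with `h`, with the entries of the transpose of
`Y` inserted. -/
def insertedBracket : PathMatrix K obj →ₗ[K] PathMatrix K obj →ₗ[K] PathHom K c d :=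
  LinearMap.mk₂ K
    (fun Y Z => ∑ a, ∑ b, concatTensor (mulRLFlip (doubleBracket β (Z a b) h) (Y b a)))
    (fun Y Y' Z => by simp only [Pi.add_apply, map_add, Finset.sum_add_distrib])
    (fun r Y Z => by simp only [Pi.smul_apply, map_smul, Finset.smul_sum])
    (fun Y Z Z' => by
      simp only [Pi.add_apply, map_add, LinearMap.add_apply, mulRLFlip, LinearMap.coe_mk,
        AddHom.coe_mk, Finset.sum_add_distrib]
      rfl)
    (fun r Y Z => by
      simp only [Pi.smul_apply, map_smul, LinearMap.smul_apply, mulRLFlip, LinearMap.coe_mk,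
        AddHom.coe_mk, Finset.smul_sum]
      rfl)

theorem insertedBracket_apply (Y Z : PathMatrix K obj) : insertedBracket β h Y Z =
    ∑ a, ∑ b, concatTensor (mulRL (Y b a) (doubleBracket β (Z a b) h)) := rfl

/-- After concatenation, the inner multiplications by a morphism from the left and from the right
coincide. The factor of `Z Z'` that Leibniz leaves undifferentiated is therefore absorbed into the
inserted matrix. -/
theorem insertedBracket_mul (Y Z Z' : PathMatrix K obj) :
    insertedBracket β h Y (matrixMul Z Z') =
      insertedBracket β h (matrixMul Z' Y) Z + insertedBracket β h (matrixMul Y Z) Z' := by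
  simp only [insertedBracket_apply, matrixMul_apply, map_sum, LinearMap.sum_apply,
    doubleBracket_concat_left, map_add, mulRL_sum, Finset.sum_add_distrib, mulRL_comp,
    ← mulLR_mulRL, concatTensor_mulLR]
  rw [add_comm]
  congr 1
  · exact Finset.sum_congr rfl fun a _ => Finset.sum_comm
  · rw [eq_comm]
    refine (Finset.sum_congr rfl fun a _ => Finset.sum_comm).trans (Finset.sum_comm.trans ?_)
    exact Finset.sum_congr rfl fun a _ => Finset.sum_comm

variable [DecidableEq ι]

theorem identityMatrix_mul (A : PathMatrix K obj) : matrixMul (identityMatrix obj K) A = A := by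
  ext1 i; ext1 j
  rw [matrixMul_apply, Finset.sum_eq_single i, identityMatrix_self, concat_nil_ofPath]
  · intro k _ hk
    rw [identityMatrix_of_ne hk.symm, map_zero, LinearMap.zero_apply]
  · simp

theorem mul_identityMatrix (A : PathMatrix K obj) : matrixMul A (identityMatrix obj K) = A := by
  ext1 i; ext1 j
  rw [matrixMul_apply, Finset.sum_eq_single j, identityMatrix_self, concat_ofPath_nil]
  · intro k _ hk
    rw [identityMatrix_of_ne hk, map_zero]
  · simp

theorem matrixPow_succ (X : PathMatrix K obj) (n : ℕ) :
    matrixPow X (n + 1) = matrixMul X (matrixPow X n) := rfl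

theorem matrixPow_add (X : PathMatrix K obj) (m n : ℕ) :
    matrixPow X (m + n) = matrixMul (matrixPow X m) (matrixPow X n) := by
  induction m with
  | zero => rw [zero_add, matrixPow, identityMatrix_mul]
  | succ m ih => rw [Nat.succ_add, matrixPow_succ, ih, matrixPow_succ, matrixMul_assoc]

/-- The value of a polynomial at a matrix over the path category. -/
def matrixEval (X : PathMatrix K obj) : K[X] →ₗ[K] PathMatrix K obj :=
  Polynomial.lsum fun n => LinearMap.toSpanSingleton K (PathMatrix K obj) (matrixPow X n)

theorem matrixEval_monomial (X : PathMatrix K obj) (n : ℕ) (r : K) :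
    matrixEval X (monomial n r) = r • matrixPow X n := by
  simp [matrixEval, Polynomial.sum_monomial_index]

theorem matrixEval_mul (X : PathMatrix K obj) (p q : K[X]) :
    matrixEval X (p * q) = matrixMul (matrixEval X p) (matrixEval X q) := by
  induction p using Polynomial.induction_on' with
  | add p p' hp hp' => simp only [add_mul, map_add, LinearMap.add_apply, hp, hp']
  | monomial m r =>
    induction q using Polynomial.induction_on' with
    | add q q' hq hq' => simp only [mul_add, map_add, hq, hq']
    | monomial n s =>
      simp only [monomial_mul_monomial, matrixEval_monomial, matrixPow_add, map_smul,
        LinearMap.smul_apply, smul_smul, mul_comm]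

theorem matrixEval_X_pow (X : PathMatrix K obj) (n : ℕ) :
    matrixEval X (Polynomial.X ^ n) = matrixPow X n := by
  rw [X_pow_eq_monomial, matrixEval_monomial, one_smul]

theorem matrixEval_one (X : PathMatrix K obj) : matrixEval X 1 = identityMatrix obj K := by
  rw [← pow_zero Polynomial.X, matrixEval_X_pow, matrixPow]

theorem matrixEval_X (X : PathMatrix K obj) : matrixEval X Polynomial.X = X := by
  rw [← pow_one Polynomial.X, matrixEval_X_pow, matrixPow_succ, matrixPow, mul_identityMatrix]

/-- Every inserted matrix is a polynomial in the same `X`, so the pieces around each of the `n`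
differentiated factors commute and add up as in the commutative chain rule. A general `r` is needed
because the induction enlarges the inserted polynomial. -/
theorem insertedBracket_matrixPow (X : PathMatrix K obj) (r : K[X]) (n : ℕ) :
    insertedBracket β h (matrixEval X r) (matrixPow X n) =
      insertedBracket β h (matrixEval X (r * derivative (Polynomial.X ^ n))) X := by
  induction n generalizing r with
  | zero =>
    have h0 : ∀ a b, doubleBracket β (identityMatrix obj K a b) h = 0 := fun a b => by
      by_cases hab : a = b
      · subst hab
        rw [identityMatrix_self, doubleBracket_nil_left]
      · rw [identityMatrix_of_ne hab, map_zero, LinearMap.zero_apply]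
    simp [insertedBracket_apply, matrixPow, h0]
  | succ n ih =>
    have h1 : matrixMul (matrixEval X r) X = matrixEval X (r * Polynomial.X) := by
      rw [matrixEval_mul, matrixEval_X]
    have h2 : matrixMul (matrixPow X n) (matrixEval X r) =
        matrixEval X (Polynomial.X ^ n * r) := by
      rw [matrixEval_mul, matrixEval_X_pow]
    rw [matrixPow_succ, insertedBracket_mul, h1, h2, ih, ← LinearMap.add_apply, ← map_add,
      ← map_add, pow_succ', derivative_mul, derivative_X]
    congr 3
    ring

/-- The bracket of the trace of a polynomial in a matrix. -/
theorem insertedBracket_matrixEval (X : PathMatrix K obj) (q : K[X]) :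
    insertedBracket β h (identityMatrix obj K) (matrixEval X q) =
      insertedBracket β h (matrixEval X (derivative q)) X := by
  induction q using Polynomial.induction_on' with
  | add p p' hp hp' => simp only [map_add, LinearMap.add_apply, hp, hp']
  | monomial n r =>
    have := insertedBracket_matrixPow β h X 1 n
    rw [matrixEval_one, one_mul] at this
    rw [matrixEval_monomial, map_smul, this, ← smul_X_eq_monomial, derivative_smul, map_smul,
      map_smul, LinearMap.smul_apply]

/-- Inserting the identity selects the diagonal, which links brackets on the cyclic space to the
calculus of inserted matrices. -/
theorem cyclicBracket_trace (k l : ι) (g : PathHom K (obj k) (obj l)) (A : PathMatrix K obj) :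
    cyclicBracket obj β k l (∑ i, cyc obj i (A i i)) g =
      insertedBracket β g (identityMatrix obj K) A := by
  rw [map_sum, LinearMap.sum_apply, insertedBracket_apply]
  refine Finset.sum_congr rfl fun i _ => ?_
  rw [Finset.sum_eq_single i, identityMatrix_self, mulRL_nil, cyclicBracket_cyc]
  · rfl
  · intro j _ hj
    rw [identityMatrix_of_ne hj, mulRL_zero, map_zero]
  · simp

/-! ### The logarithm modulo powers of `X`. -/

/-- The truncated logarithmic series. -/
def logPoly (K : Type*) [Field K] (m : ℕ) : K[X] :=
  ∑ n ∈ Finset.range m, monomial n (if n = 0 then 0 else (-1) ^ (n + 1) / (n : K))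

/-- The derivative is a finite geometric sum in `-X`, which telescopes against `1 + X`. -/
theorem derivative_logPoly [CharZero K] (m : ℕ) :
    (1 + Polynomial.X) * derivative (logPoly K (m + 1)) = 1 - (-Polynomial.X) ^ m := by
  induction m with
  | zero => simp [logPoly]
  | succ m ih =>
    have h1 : logPoly K (m + 1 + 1) = logPoly K (m + 1) +
        monomial (m + 1) (if m + 1 = 0 then 0 else (-1) ^ (m + 1 + 1) / ((m + 1 : ℕ) : K)) :=
      Finset.sum_range_succ _ _
    have h2 : (derivative (monomial (m + 1) (if m + 1 = 0 then 0 else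
        (-1) ^ (m + 1 + 1) / ((m + 1 : ℕ) : K))) : K[X]) = (-Polynomial.X) ^ m := by
      have h3 : ((m + 1 : ℕ) : K) ≠ 0 := Nat.cast_ne_zero.2 (by omega)
      rw [if_neg (by omega), derivative_monomial, div_mul_cancel₀ _ h3, Nat.add_sub_cancel,
        ← C_mul_X_pow_eq_monomial, neg_pow (Polynomial.X : K[X])]
      simp [pow_succ]
    rw [h1, map_add, mul_add, ih, h2]
    ring

/-- A truncation of the formal identity (1 + X)·L·L' = L for L = log(1 + X). The degree shift
reflects that the bracket loses one step of the filtration. -/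
theorem dvd_logPoly [CharZero K] (m : ℕ) : (Polynomial.X : K[X]) ^ m ∣
    (1 + Polynomial.X) * (logPoly K (m + 1) * derivative (logPoly K (m + 1))) - logPoly K m := by
  have h1 : logPoly K (m + 1) = logPoly K m +
      monomial m (if m = 0 then 0 else (-1) ^ (m + 1) / (m : K)) := Finset.sum_range_succ _ _
  have h2 : (1 + Polynomial.X) * (logPoly K (m + 1) * derivative (logPoly K (m + 1))) -
      logPoly K m = Polynomial.X ^ m * (C (if m = 0 then 0 else (-1) ^ (m + 1) / (m : K)) -
        logPoly K (m + 1) * (-1) ^ m) := by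
    rw [mul_left_comm, derivative_logPoly, neg_pow (Polynomial.X : K[X]), mul_sub, mul_one]
    rw [← C_mul_X_pow_eq_monomial] at h1
    linear_combination h1
  exact ⟨_, h2⟩

theorem matrixEval_logPoly (X : PathMatrix K obj) (m : ℕ) (i j : ι) :
    matrixEval X (logPoly K m) i j = ∑ n ∈ Finset.range m,
      (if n = 0 then 0 else (-1) ^ (n + 1) / (n : K)) • matrixPow X n i j := by
  simp only [logPoly, map_sum, matrixEval_monomial, Finset.sum_apply, Pi.smul_apply]

theorem PathIdeal.matrixEval_mem_of_dvd (J : PathIdeal K obj) {X : PathMatrix K obj}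
    (hX : ∀ i j, X i j ∈ J.carrier i j) {m : ℕ} {p : K[X]} (hp : Polynomial.X ^ m ∣ p) (i j : ι) :
    matrixEval X p i j ∈ J.pow m i j := by
  obtain ⟨q, rfl⟩ := hp
  rw [matrixEval_mul, matrixEval_X_pow, matrixMul_apply]
  exact Submodule.sum_mem _ fun k _ => J.pow_concat_right _ (J.matrixPow_mem hX m i k)

end MatrixCalculus

/-! ## The Hamilton flow -/

namespace CylindricalNetwork

open Polynomial

variable {N : ℕ} (Γ : CylindricalNetwork N N) {K : Type*} [Field K] {lam mu : K}

theorem doubleBracket_shiftedMeasurement (β : ArrowBracket K Γ.TorusVertex)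
    {c d : Γ.TorusVertex} (h : PathHom K c d) (i j : Fin N) :
    doubleBracket β (Γ.shiftedMeasurement lam i j) h =
      doubleBracket β (Γ.boundaryMeasurement lam i j) h := by
  have h0 : Γ.boundaryMeasurement lam i j =
      Γ.shiftedMeasurement lam i j + identityMatrix Γ.marked K i j := (sub_add_cancel _ _).symm
  have h1 : doubleBracket β (identityMatrix Γ.marked K i j) h = 0 := by
    by_cases hij : i = j
    · subst hij
      rw [identityMatrix_self, doubleBracket_nil_left]
    · rw [identityMatrix_of_ne hij, map_zero, LinearMap.zero_apply]
  rw [h0, map_add, LinearMap.add_apply, h1, add_zero]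

theorem matrixEval_one_add_X :
    matrixEval (Γ.shiftedMeasurement lam) (1 + Polynomial.X) = Γ.boundaryMeasurement lam := by
  rw [map_add, matrixEval_one, matrixEval_X]
  ext1 i; ext1 j
  exact add_sub_cancel _ _

/-- In each term of the quadratic formula `Y` joins the two tensor factors, so it meets B(λ) from
the right in the first term and from the left in the second. The ρ coefficient does not involve the
index summed in that product, hence weights the product entrywise. -/
theorem insertedBracket_boundaryMeasurement [CharZero K] (hlam : lam ≠ 0) (hmu : mu ≠ 0)
    (hne : lam ≠ mu) (Y : PathMatrix K Γ.marked) (k l : Fin N) :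
    insertedBracket (Γ.edgeBracket K) (Γ.boundaryMeasurement mu k l) Y
      (Γ.shiftedMeasurement lam) =
      ∑ a, concat (rhoCoeff lam mu a k • matrixMul (Γ.boundaryMeasurement lam) Y k a)
        (Γ.boundaryMeasurement mu a l) -
      ∑ b, concat (Γ.boundaryMeasurement mu k b)
        (rhoCoeff lam mu l b • matrixMul Y (Γ.boundaryMeasurement lam) b l) := by
  simp only [insertedBracket_apply, doubleBracket_shiftedMeasurement,
    Γ.doubleBracket_boundaryMeasurement hlam hmu hne, map_sub, map_smul, mulRL,
    LinearMap.rTensor_tmul, LinearMap.flip_apply, concatTensor, TensorProduct.lift.tmul,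
    matrixMul_apply, Finset.sum_sub_distrib, map_sum, LinearMap.sum_apply, LinearMap.smul_apply,
    Finset.smul_sum, concat_assoc]
  congr 1
  exact Finset.sum_comm

variable (J : PathIdeal K Γ.marked)

theorem completion_sub_val {i j : Fin N} (x y : J.completion i j) (m : ℕ) :
    (x - y).1 m = x.1 m - y.1 m :=
  eq_sub_of_add_eq (congrFun (congrArg Subtype.val (sub_add_cancel x y)) m)

theorem hatMul_val (A B : J.HatMatrix) (i j : Fin N) (m : ℕ) :
    (J.hatMul A B i j).1 m = ∑ k, J.concatMod m i k j ((A i k).1 m) ((B k j).1 m) := by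
  rw [PathIdeal.hatMul, Submodule.coe_sum, Finset.sum_apply]
  rfl

variable (hJ : ∀ i j : Fin N, Γ.shiftedMeasurement lam i j ∈ J.carrier i j)

theorem logMeasurement_val (i j : Fin N) (m : ℕ) : (Γ.logMeasurement J hJ i j).1 m =
    (J.pow m i j).mkQ (matrixEval (Γ.shiftedMeasurement lam) (logPoly K m) i j) := by
  rw [matrixEval_logPoly]
  rfl

theorem hatMul_logMeasurement_val (i j : Fin N) (m : ℕ) :
    (J.hatMul (Γ.logMeasurement J hJ) (Γ.logMeasurement J hJ) i j).1 m =
      (J.pow m i j).mkQ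
        (matrixEval (Γ.shiftedMeasurement lam) (logPoly K m * logPoly K m) i j) := by
  rw [hatMul_val, matrixEval_mul, matrixMul_apply, map_sum]
  refine Finset.sum_congr rfl fun k _ => ?_
  rw [logMeasurement_val, logMeasurement_val, PathIdeal.concatMod_mk]

theorem hamiltonian_val (m : ℕ) : (Γ.hamiltonian J hJ).1 m =
    (J.cyclicPow m).mkQ ((1 / 2 : K) • ∑ i, cyc Γ.marked i
      (matrixEval (Γ.shiftedMeasurement lam) (logPoly K m * logPoly K m) i i)) := by
  rw [hamiltonian, PathIdeal.hatTrace, Submodule.coe_smul, Submodule.coe_sum, Pi.smul_apply,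
    Finset.sum_apply, map_smul, map_sum]
  congr 1
  refine Finset.sum_congr rfl fun i _ => ?_
  change Submodule.mapQ _ _ _ _ _ = _
  rw [hatMul_logMeasurement_val]
  rfl

/-- The ½ cancels the 2 from differentiating a square. B(λ) = 1 + X commutes with polynomials in
`X`, so the left and right products are the same matrix, as a commutator requires. -/
theorem cyclicBracket_trace_logPoly_sq [CharZero K] (hlam : lam ≠ 0) (hmu : mu ≠ 0)
    (hne : lam ≠ mu) (k l : Fin N) (p : K[X]) :
    cyclicBracket Γ.marked (Γ.edgeBracket K) k l ((1 / 2 : K) • ∑ i, cyc Γ.marked i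
        (matrixEval (Γ.shiftedMeasurement lam) (p * p) i i)) (Γ.boundaryMeasurement mu k l) =
      ∑ a, concat (rhoCoeff lam mu a k • matrixEval (Γ.shiftedMeasurement lam)
          ((1 + Polynomial.X) * (p * derivative p)) k a) (Γ.boundaryMeasurement mu a l) -
      ∑ b, concat (Γ.boundaryMeasurement mu k b)
        (rhoCoeff lam mu l b • matrixEval (Γ.shiftedMeasurement lam)
          ((1 + Polynomial.X) * (p * derivative p)) b l) := by
  have h1 : (1 / 2 : K) • derivative (p * p) = p * derivative p := by
    rw [derivative_mul, mul_comm (derivative p), ← two_smul K, smul_smul,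
      one_div_mul_cancel two_ne_zero, one_smul]
  have h2 := insertedBracket_matrixEval (Γ.edgeBracket K) (Γ.boundaryMeasurement mu k l)
    (Γ.shiftedMeasurement lam) (p * p)
  have h3 : matrixMul (matrixEval (Γ.shiftedMeasurement lam) (p * derivative p))
      (Γ.boundaryMeasurement lam) = matrixEval (Γ.shiftedMeasurement lam)
        ((1 + Polynomial.X) * (p * derivative p)) := by
    rw [mul_comm (1 + Polynomial.X), matrixEval_mul _ (p * derivative p), matrixEval_one_add_X]
  have h4 : matrixMul (Γ.boundaryMeasurement lam)
      (matrixEval (Γ.shiftedMeasurement lam) (p * derivative p)) =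
        matrixEval (Γ.shiftedMeasurement lam)
          ((1 + Polynomial.X) * (p * derivative p)) := by
    rw [matrixEval_mul _ (1 + Polynomial.X), matrixEval_one_add_X]
  rw [map_smul, LinearMap.smul_apply]
  refine (congrArg _ ((cyclicBracket_trace _ k l _ _).trans h2)).trans ?_
  rw [← LinearMap.smul_apply, ← map_smul, ← map_smul, h1,
    Γ.insertedBracket_boundaryMeasurement hlam hmu hne, h3, h4]

/-- The Hamilton flow of `1/2 tr (log B)²`. -/
theorem hatBracket_hamiltonian [CharZero K] (hlam : lam ≠ 0) (hmu : mu ≠ 0) (hne : lam ≠ mu)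
    (k l : Fin N) :
    J.hatBracket (Γ.edgeBracket K) (Γ.hamiltonian J hJ) (Γ.hatMeasurement J mu k l) =
      J.hatMul (Γ.laxMatrix J hJ mu) (Γ.hatMeasurement J mu) k l -
        J.hatMul (Γ.hatMeasurement J mu) (Γ.laxMatrix J hJ mu) k l := by
  refine Subtype.ext (funext fun m => ?_)
  -- Level `m` of the bracket is computed from level `m + 1` of the Hamiltonian. At level `m`, log
  -- B(λ) may be represented by the polynomial this produces, since the two differ by a multiple of
  -- X^m, which lies in J^m.
  have hmod : ∀ i j, (Γ.logMeasurement J hJ i j).1 m = (J.pow m i j).mkQ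
      (matrixEval (Γ.shiftedMeasurement lam) ((1 + Polynomial.X) *
        (logPoly K (m + 1) * derivative (logPoly K (m + 1)))) i j) := fun i j => by
    rw [logMeasurement_val, eq_comm, ← sub_eq_zero, ← map_sub, ← Pi.sub_apply, ← Pi.sub_apply,
      ← map_sub, Submodule.mkQ_apply, Submodule.Quotient.mk_eq_zero]
    exact J.matrixEval_mem_of_dvd hJ (dvd_logPoly m) i j
  have hlax : ∀ i j, (Γ.laxMatrix J hJ mu i j).1 m = (J.pow m i j).mkQ
      (rhoCoeff lam mu j i • matrixEval (Γ.shiftedMeasurement lam) ((1 + Polynomial.X) *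
        (logPoly K (m + 1) * derivative (logPoly K (m + 1)))) i j) := fun i j => by
    rw [map_smul, ← hmod]
    rfl
  have hmeas : ∀ i j, (Γ.hatMeasurement J mu i j).1 m =
      (J.pow m i j).mkQ (Γ.boundaryMeasurement mu i j) := fun i j => rfl
  rw [completion_sub_val]
  change J.bracketMod _ m k l ((Γ.hamiltonian J hJ).1 (m + 1)) _ = _
  rw [hatMul_val, hatMul_val, hamiltonian_val]
  simp only [hlax, hmeas, PathIdeal.concatMod_mk]
  rw [← map_sum, ← map_sum, ← map_sub,
    ← Γ.cyclicBracket_trace_logPoly_sq hlam hmu hne k l (logPoly K (m + 1))]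
  rfl

end CylindricalNetwork

/-! ### Specialization to ℂ(λ, μ). -/

theorem spectralLam_ne_zero : spectralLam ≠ 0 := by
  rw [spectralLam, Ne, IsFractionRing.to_map_eq_zero_iff]
  exact MvPolynomial.X_ne_zero 0

theorem spectralMu_ne_zero : spectralMu ≠ 0 := by
  rw [spectralMu, Ne, IsFractionRing.to_map_eq_zero_iff]
  exact MvPolynomial.X_ne_zero 1

theorem spectralLam_ne_spectralMu : spectralLam ≠ spectralMu := fun h =>
  absurd (MvPolynomial.X_injective (IsFractionRing.injective _ _ h)) (by decide)

end

theorem mainTheorem6 (N : ℕ) (Γ : CylindricalNetwork N N)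
    (J : PathIdeal SpectralField Γ.marked)
    (hJ : ∀ i j : Fin N, Γ.shiftedMeasurement spectralLam i j ∈ J.carrier i j)
    (b₁ b₂ : Fin N) :
    J.hatBracket (Γ.edgeBracket SpectralField) (Γ.hamiltonian J hJ)
        (Γ.hatMeasurement J spectralMu b₁ b₂) =
      J.hatMul (Γ.laxMatrix J hJ spectralMu) (Γ.hatMeasurement J spectralMu) b₁ b₂ -
        J.hatMul (Γ.hatMeasurement J spectralMu) (Γ.laxMatrix J hJ spectralMu) b₁ b₂ := by
  have : CharZero SpectralField :=
    charZero_of_injective_algebraMap (IsFractionRing.injective (MvPolynomial (Fin 2) ℂ) _)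
  exact Γ.hatBracket_hamiltonian J hJ spectralLam_ne_zero spectralMu_ne_zero
    spectralLam_ne_spectralMu b₁ b₂
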